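/- Let $\mathbb K$ be a field of characteristic different from $2$, and let $(\mathcal A,A,A')$ be a quasi-twilled associative algebra over $\mathbb K$: $\mathcal A$ is a (not necessarily unital) associative $\mathbb K$-algebra with a decomposition $\mathcal A=A\oplus A'$ into two subspaces such that $A'$ is a subalgebra. Write the multiplication of $\mathcal A$ as $\Omega=\pi+\xi+\eta+\beta+\rho+\mu+\theta$ with components $\pi:A\otimes A\to A$, $\xi:A\otimes A'\to A$, $\eta:A'\otimes A\to A$, $\beta:A'\otimes A'\to A'$, $\rho:A\otimes A'\to A'$, $\mu:A'\otimes A\to A'$, $\theta:A\otimes A\to A'$. A multilinear map $f$ between copies of $A$ and $A'$ is identified with its lift, the multilinear map on $\mathcal A$ with values in $\mathcal A$ that equals $f$ on the domain of $f$ and vanishes on all other tensor products of $A$ and $A'$. Recall that a curved V-data $(L,F,P,\Delta)$ consists of a graded Lie algebra $(L=\bigoplus_i L^i,[\cdot,\cdot])$, an abelian graded Lie subalgebra $F$, a linear map $P:L\to L$ with $P\circ P=P$ whose image is $F$ and whose kernel is a graded Lie subalgebra, and $\Delta\in L^1$ with $[\Delta,\Delta]=0$. A curved $L_\infty$-algebra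 is a $\mathbb Z$-graded vector space $\mathfrak g$ with linear maps $l_k:\otimes^k\mathfrak g\to\mathfrak g$ of degree $1$, $k\ge 0$, such that for all homogeneous $x_1,\dots,x_n$ one has $l_n(x_{\sigma(1)},\dots,x_{\sigma(n)})=\varepsilon(\sigma)\,l_n(x_1,\dots,x_n)$ for all $\sigma\in S_n$, and, for all $n\ge0$, $$\sum_{i=0}^n\ \sum_{\sigma\in S(i,n-i)}\varepsilon(\sigma)\,l_{n-i+1}\bigl(l_i(x_{\sigma(1)},\dots,x_{\sigma(i)}),x_{\sigma(i+1)},\dots,x_{\sigma(n)}\bigr)=0,$$ where $S(i,n-i)$ is the set of $(i,n-i)$-shuffles and $\varepsilon(\sigma)$ is the Koszul sign. A Maurer–Cartan element of it is an $x\in\mathfrak g^0$ such that only finitely many $l_k(x,\dots,x)$ are nonzero and $l_0+\sum_{k\ge1}\frac1{k!}l_k(x,\dots,x)=0$. Then the following $(L,F,P,\Delta)$ is a curved V-data: - $L=\bigoplus_{n\ge0}\mathrm{Hom}(\otimes^{n+1}\mathcal A,\mathcal A)$, with $\mathrm{Hom}(\otimes^{n+1}\mathcal A,\mathcal A)$ in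 degree $n$, with the Gerstenhaber bracket $[f,g]_G=f\circ g-(-1)^{(m-1)(n-1)}g\circ f$ for $f\in\mathrm{Hom}(\otimes^m\mathcal A,\mathcal A)$, $g\in\mathrm{Hom}(\otimes^n\mathcal A,\mathcal A)$, where $(f\circ g)(x_1,\dots,x_{m+n-1})=\sum_{i=1}^m(-1)^{(i-1)(n-1)}f(x_1,\dots,x_{i-1},g(x_i,\dots,x_{i+n-1}),x_{i+n},\dots,x_{m+n-1})$; - $F=\bigoplus_{n\ge0}\mathrm{Hom}(\otimes^{n+1}A,A')$, embedded in $L$ by the lift, which is injective; - $P:L\to L$ is the projection onto $F$ that restricts a cochain to $\otimes^{n+1}A$ and projects its values to $A'$ along $A$; - $\Delta=\Omega=\pi+\xi+\eta+\beta+\rho+\mu+\theta$. Consequently $F$, with the grading induced from $L$, is a curved $L_\infty$-algebra with the brackets $l_k(f_1,\dots,f_k)=P[\cdots[[\Delta,f_1]_G,f_2]_G,\cdots,f_k]_G$, $k\ge0$, and these are given, for $f,g\in F$, by $$l_0=\theta,\qquad l_1(f)=[\pi+\rho+\mu,f]_G,\qquad l_2(f,g)=[[\xi+\eta+\beta,f]_G,g]_G,\qquad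 l_k=0\quad(k\ge3).$$ Furthermore, a linear map $D:A\to A'$ is a right deformation map of $(\mathcal A,A,A')$, that is, $$D\bigl(\pi(x,y)+\xi(x,D(y))+\eta(D(x),y)\bigr)=\rho(x,D(y))+\mu(D(x),y)+\beta(D(x),D(y))+\theta(x,y)\quad\text{for all }x,y\in A,$$ if and only if $D$ is a Maurer–Cartan element of this curved $L_\infty$-algebra. -/

import Mathlib

open scoped DirectSum

noncomputable section

namespace QuasiTwilled

/-! ### Graded Lie algebras, curved V-data and curved `L∞`-algebras -/

section General

variable {K : Type*} [Field K] {L : Type*} [AddCommGroup L] [Module K L]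

/-- `L = ⨁ 𝒢 i` is a `ℤ`-graded Lie algebra under the bilinear bracket `br`. -/
structure IsGradedLieAlgebra (𝒢 : ℤ → Submodule K L) (br : L →ₗ[K] L →ₗ[K] L) : Prop where
  internal : DirectSum.IsInternal 𝒢
  degree : ∀ i j x y, x ∈ 𝒢 i → y ∈ 𝒢 j → br x y ∈ 𝒢 (i + j)
  skew : ∀ i j x y, x ∈ 𝒢 i → y ∈ 𝒢 j → br x y = -((i * j).negOnePow • br y x)
  jacobi : ∀ i j k x y z, x ∈ 𝒢 i → y ∈ 𝒢 j → z ∈ 𝒢 k →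
    br x (br y z) = br (br x y) z + (i * j).negOnePow • br y (br x z)

/-- `S` is a graded Lie subalgebra: it is spanned by its homogeneous elements and closed under
the bracket. -/
structure IsGradedLieSubalgebra (𝒢 : ℤ → Submodule K L) (br : L →ₗ[K] L →ₗ[K] L)
    (S : Submodule K L) : Prop where
  graded : S = ⨆ i, S ⊓ 𝒢 i
  closed : ∀ x ∈ S, ∀ y ∈ S, br x y ∈ S

/-- `(L, F, P, Δ)` is a curved V-data. -/
structure IsCurvedVData (𝒢 : ℤ → Submodule K L) (br : L →ₗ[K] L →ₗ[K] L)
    (F : Submodule K L) (P : L →ₗ[K] L) (Δ : L) : Prop where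
  gradedLie : IsGradedLieAlgebra 𝒢 br
  subalgebra : IsGradedLieSubalgebra 𝒢 br F
  abelian : ∀ x ∈ F, ∀ y ∈ F, br x y = 0
  proj : P ∘ₗ P = P
  range_proj : LinearMap.range P = F
  ker_proj : IsGradedLieSubalgebra 𝒢 br (LinearMap.ker P)
  degree_one : Δ ∈ 𝒢 1
  square_zero : br Δ Δ = 0

/-- The iterated bracket `(x₁, …, xₖ) ↦ [⋯[[Δ, x₁], x₂], ⋯, xₖ]`. -/
def iteratedBracket (br : L →ₗ[K] L →ₗ[K] L) (Δ : L) :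
    (k : ℕ) → MultilinearMap K (fun _ : Fin k => L) L
  | 0 => MultilinearMap.constOfIsEmpty K _ Δ
  | k + 1 => MultilinearMap.uncurryRight (M := fun _ : Fin (k + 1) => L)
      (br.compMultilinearMap (iteratedBracket br Δ k))

/-- The derived brackets `lₖ(x₁, …, xₖ) = P [⋯[[Δ, x₁], x₂], ⋯, xₖ]` on `F`; in particular
`l₀ = P Δ`. -/
def derivedBracket (br : L →ₗ[K] L →ₗ[K] L) (F : Submodule K L) (P : L →ₗ[K] L)
    (hP : ∀ x, P x ∈ F) (Δ : L) (k : ℕ) : MultilinearMap K (fun _ : Fin k => F) F :=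
  (P.codRestrict F hP).compMultilinearMap
    ((iteratedBracket br Δ k).compLinearMap fun _ => F.subtype)

/-- The grading that a subspace `F` inherits: `Fⁱ = F ∩ Lⁱ`. -/
def inducedGrading (𝒢 : ℤ → Submodule K L) (F : Submodule K L) (i : ℤ) : Submodule K F :=
  (𝒢 i).comap F.subtype

/-- The Koszul sign `ε(σ; x₁, …, xₙ)` for elements of degrees `d₁, …, dₙ`: the product of
`(-1)^{d_a d_b}` over all pairs whose order is reversed in `x_{σ(1)}, …, x_{σ(n)}`. -/
def koszulSign {n : ℕ} (d : Fin n → ℤ) (σ : Equiv.Perm (Fin n)) : ℤˣ :=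
  ∏ p : Fin n × Fin n with p.1 < p.2 ∧ σ p.2 < σ p.1, (d (σ p.1) * d (σ p.2)).negOnePow

/-- `σ` is an `(i, n - i)`-shuffle: `σ(1) < ⋯ < σ(i)` and `σ(i+1) < ⋯ < σ(n)`. -/
def IsShuffle {n : ℕ} (i : ℕ) (σ : Equiv.Perm (Fin n)) : Prop :=
  ∀ a b : Fin n, a < b → ((b : ℕ) < i ∨ i ≤ (a : ℕ)) → σ a < σ b

/-- `l_{n-i+1}(l_i(y₁, …, y_i), y_{i+1}, …, y_n)`. -/
def nestedTerm (l : (k : ℕ) → MultilinearMap K (fun _ : Fin k => L) L) {n : ℕ}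
    (i : Fin (n + 1)) (y : Fin n → L) : L :=
  l (n - i + 1) (Fin.cons (α := fun _ => L)
    (l i fun a : Fin i => y ⟨a, by omega⟩)
    fun b : Fin (n - i) => y ⟨i + b, by omega⟩)

open Classical in
/-- `(L, {lₖ}_{k ≥ 0})` is a curved `L∞`-algebra on the graded space `L = ⨁ 𝒢 i`. -/
structure IsCurvedLInfinity (𝒢 : ℤ → Submodule K L)
    (l : (k : ℕ) → MultilinearMap K (fun _ : Fin k => L) L) : Prop where
  internal : DirectSum.IsInternal 𝒢
  degree : ∀ (k : ℕ) (x : Fin k → L) (d : Fin k → ℤ), (∀ a, x a ∈ 𝒢 (d a)) →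
    l k x ∈ 𝒢 (∑ a, d a + 1)
  symm : ∀ (n : ℕ) (x : Fin n → L) (d : Fin n → ℤ), (∀ a, x a ∈ 𝒢 (d a)) →
    ∀ σ : Equiv.Perm (Fin n), l n (fun a => x (σ a)) = koszulSign d σ • l n x
  jacobi : ∀ (n : ℕ) (x : Fin n → L) (d : Fin n → ℤ), (∀ a, x a ∈ 𝒢 (d a)) →
    ∑ i : Fin (n + 1), ∑ σ : Equiv.Perm (Fin n) with IsShuffle i σ,
      koszulSign d σ • nestedTerm l i (fun a => x (σ a)) = 0

/-- `x` is a Maurer–Cartan element: it has degree `0`, only finitely many `lₖ(x, …, x)` are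
nonzero, and `l₀ + ∑_{k ≥ 1} (1 / k!) lₖ(x, …, x) = 0` (the summand `k = 0` below is `l₀`). -/
structure IsMaurerCartan (𝒢 : ℤ → Submodule K L)
    (l : (k : ℕ) → MultilinearMap K (fun _ : Fin k => L) L) (x : L) : Prop where
  degree_zero : x ∈ 𝒢 0
  finite : {k : ℕ | l k (fun _ => x) ≠ 0}.Finite
  sum_eq_zero : ∑ᶠ k : ℕ, ((k.factorial : K)⁻¹ • l k (fun _ => x)) = 0

end General

/-! ### Cochains and the Gerstenhaber bracket -/

section Gerstenhaber

variable (K : Type*) [Field K] (V W : Type*) [AddCommGroup V] [Module K V]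
  [AddCommGroup W] [Module K W]

/-- `Hom(⊗ⁿ⁺¹ V, W)`, placed in degree `n`. -/
abbrev Cochain (n : ℕ) : Type _ := MultilinearMap K (fun _ : Fin (n + 1) => V) W

/-- The graded vector space `⨁_{n ≥ 0} Hom(⊗ⁿ⁺¹ V, W)`. -/
abbrev Cochains : Type _ := ⨁ n : ℕ, Cochain K V W n

/-- The homogeneous part of degree `i ∈ ℤ`: `Hom(⊗ⁱ⁺¹ V, W)` if `i ≥ 0`, and `0` if `i < 0`. -/
def cochainGrading : ℤ → Submodule K (Cochains K V W)
  | Int.ofNat n => LinearMap.range (DirectSum.lof K ℕ (Cochain K V W) n)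
  | Int.negSucc _ => ⊥

variable {K V}

/-- The list `x₁, …, x_{i-1}, g(x_i, …, x_{i+n}), x_{i+n+1}, …` (with `i` counted from `0`). -/
def insertArgs {m n : ℕ} (g : Cochain K V V n) (i : Fin (m + 1)) (x : Fin (m + n + 1) → V) :
    Fin (m + 1) → V := fun j =>
  if j < i then x ⟨j, by omega⟩
  else if j = i then g fun k => x ⟨i + k, by omega⟩
  else x ⟨j + n, by omega⟩

theorem insertArgs_eq_update {m n : ℕ} (g : Cochain K V V n) (i : Fin (m + 1))
    (x : Fin (m + n + 1) → V) :
    insertArgs g i x =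
      Function.update (insertArgs (0 : Cochain K V V n) i x) i (g fun k => x ⟨i + k, by omega⟩) := by
  funext j
  by_cases h : j = i
  · subst h; simp [insertArgs]
  · simp [insertArgs, h]

theorem insertArgs_update_lt {m n : ℕ} (g : Cochain K V V n) (i : Fin (m + 1))
    (x : Fin (m + n + 1) → V) (p : Fin (m + n + 1)) (h : (p : ℕ) < i) (c : V) :
    insertArgs g i (Function.update x p c) =
      Function.update (insertArgs g i x) ⟨p, by omega⟩ c := by
  have hk : (fun k : Fin (n + 1) => Function.update x p c ⟨i + k, by omega⟩) =
      fun k : Fin (n + 1) => x ⟨i + k, by omega⟩ := by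
    funext k
    rw [Function.update_of_ne]
    intro e; have := congrArg Fin.val e; simp at this; omega
  funext j
  by_cases hj : j = i
  · subst hj
    rw [Function.update_of_ne (by rw [Ne, Fin.ext_iff]; simp; omega)]
    simp [insertArgs, hk]
  · simp only [insertArgs, Function.update_apply, Fin.ext_iff, Fin.lt_def]
    rw [Fin.ext_iff] at hj
    split_ifs <;> first | rfl | omega

theorem insertArgs_update_gt {m n : ℕ} (g : Cochain K V V n) (i : Fin (m + 1))
    (x : Fin (m + n + 1) → V) (p : Fin (m + n + 1)) (h : (i : ℕ) + n < p) (c : V) :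
    insertArgs g i (Function.update x p c) =
      Function.update (insertArgs g i x) ⟨p - n, by omega⟩ c := by
  have hk : (fun k : Fin (n + 1) => Function.update x p c ⟨i + k, by omega⟩) =
      fun k : Fin (n + 1) => x ⟨i + k, by omega⟩ := by
    funext k
    rw [Function.update_of_ne]
    intro e; have := congrArg Fin.val e; simp at this; omega
  funext j
  by_cases hj : j = i
  · subst hj
    rw [Function.update_of_ne (by rw [Ne, Fin.ext_iff]; simp; omega)]
    simp [insertArgs, hk]
  · simp only [insertArgs, Function.update_apply, Fin.ext_iff, Fin.lt_def]
    rw [Fin.ext_iff] at hj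
    split_ifs <;> first | rfl | omega

theorem insertArgs_update_mid {m n : ℕ} (g : Cochain K V V n) (i : Fin (m + 1))
    (x : Fin (m + n + 1) → V) (p : Fin (m + n + 1)) (h : (i : ℕ) ≤ p) (h' : (p : ℕ) ≤ i + n)
    (c : V) :
    insertArgs g i (Function.update x p c) =
      Function.update (insertArgs g i x) i
        (g (Function.update (fun k : Fin (n + 1) => x ⟨i + k, by omega⟩)
          ⟨p - i, by omega⟩ c)) := by
  have hk : (fun k : Fin (n + 1) => Function.update x p c ⟨i + k, by omega⟩) =
      Function.update (fun k : Fin (n + 1) => x ⟨i + k, by omega⟩) ⟨p - i, by omega⟩ c := by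
    funext k
    simp only [Function.update_apply, Fin.ext_iff]
    split_ifs <;> first | rfl | omega
  funext j
  by_cases hj : j = i
  · subst hj; simp [insertArgs, hk]
  · simp only [insertArgs, Function.update_apply, Fin.ext_iff, Fin.lt_def]
    rw [Fin.ext_iff] at hj
    split_ifs <;> first | rfl | omega

/-- The `i`-th partial composition
`f(x₁, …, x_{i-1}, g(x_i, …, x_{i+n}), x_{i+n+1}, …)` (with `i` counted from `0`). -/
def insertAt {m n : ℕ} (f : Cochain K V V m) (g : Cochain K V V n) (i : Fin (m + 1)) :
    Cochain K V V (m + n) :=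
  MultilinearMap.mk' (fun x => f (insertArgs g i x))
    (by
      intro x p a b
      rcases lt_or_ge (p : ℕ) i with h | h
      · simp only [insertArgs_update_lt g i x p h, MultilinearMap.map_update_add]
      · rcases le_or_gt (p : ℕ) (i + n) with h' | h'
        · simp only [insertArgs_update_mid g i x p h h', MultilinearMap.map_update_add]
        · simp only [insertArgs_update_gt g i x p h', MultilinearMap.map_update_add])
    (by
      intro x p c a
      rcases lt_or_ge (p : ℕ) i with h | h
      · simp only [insertArgs_update_lt g i x p h, MultilinearMap.map_update_smul]
      · rcases le_or_gt (p : ℕ) (i + n) with h' | h'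
        · simp only [insertArgs_update_mid g i x p h h', MultilinearMap.map_update_smul]
        · simp only [insertArgs_update_gt g i x p h', MultilinearMap.map_update_smul])

theorem insertAt_apply {m n : ℕ} (f : Cochain K V V m) (g : Cochain K V V n) (i : Fin (m + 1))
    (x : Fin (m + n + 1) → V) : insertAt f g i x = f (insertArgs g i x) := rfl

/-- `f ∘ g = ∑ᵢ (-1)^{i n} f(x₁, …, g(x_i, …), …)`, with `i` counted from `0`, for `f` of degree
`m` and `g` of degree `n` (that is, with `m + 1` and `n + 1` arguments), as a bilinear map. -/
def circ (m n : ℕ) :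
    Cochain K V V m →ₗ[K] Cochain K V V n →ₗ[K] Cochain K V V (m + n) :=
  LinearMap.mk₂ K (fun f g => ∑ i : Fin (m + 1), (-1 : K) ^ ((i : ℕ) * n) • insertAt f g i)
    (by
      intro f f' g
      rw [← Finset.sum_add_distrib]
      refine Finset.sum_congr rfl fun i _ => ?_
      rw [← smul_add]
      rfl)
    (by
      intro c f g
      rw [Finset.smul_sum]
      refine Finset.sum_congr rfl fun i _ => ?_
      rw [smul_comm]
      rfl)
    (by
      intro f g g'
      rw [← Finset.sum_add_distrib]
      refine Finset.sum_congr rfl fun i _ => ?_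
      rw [← smul_add]
      congr 1
      ext x
      simp only [insertAt_apply, add_apply]
      rw [insertArgs_eq_update (g + g'), insertArgs_eq_update g, insertArgs_eq_update g',
        add_apply, MultilinearMap.map_update_add])
    (by
      intro c f g
      rw [Finset.smul_sum]
      refine Finset.sum_congr rfl fun i _ => ?_
      rw [smul_comm]
      congr 1
      ext x
      simp only [insertAt_apply, smul_apply]
      rw [insertArgs_eq_update (c • g), insertArgs_eq_update g,
        smul_apply, MultilinearMap.map_update_smul])

variable (K V)

/-- The Gerstenhaber bracket `[f, g] = f ∘ g - (-1)^{m n} g ∘ f` for `f`, `g` of degrees `m`, `n`,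
with values in the total space. -/
def bracketHom (m n : ℕ) :
    Cochain K V V m →ₗ[K] Cochain K V V n →ₗ[K] Cochains K V V :=
  LinearMap.mk₂ K
    (fun f g => DirectSum.lof K ℕ (Cochain K V V) (m + n) (circ m n f g) -
      (-1 : K) ^ (m * n) • DirectSum.lof K ℕ (Cochain K V V) (n + m) (circ n m g f))
    (by intro f f' g; simp only [map_add, LinearMap.add_apply, smul_add]; abel)
    (by
      intro c f g
      simp only [map_smul, LinearMap.smul_apply, smul_sub]
      rw [smul_comm c])
    (by intro f g g'; simp only [map_add, LinearMap.add_apply, smul_add]; abel)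
    (by
      intro c f g
      simp only [map_smul, LinearMap.smul_apply, smul_sub]
      rw [smul_comm c])

/-- The Gerstenhaber bracket on `⨁_{n ≥ 0} Hom(⊗ⁿ⁺¹ V, V)`: the bilinear extension of
`bracketHom`. -/
def gerstenhaber : Cochains K V V →ₗ[K] Cochains K V V →ₗ[K] Cochains K V V :=
  DirectSum.toModule K ℕ _ fun m =>
    (DirectSum.toModule K ℕ _ fun n => (bracketHom K V m n).flip).flip

end Gerstenhaber

/-! ### Quasi-twilled associative algebras -/

section QuasiTwilled

variable {K : Type*} [Field K] {𝒜 : Type*} [NonUnitalRing 𝒜] [Module K 𝒜]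
  [IsScalarTower K 𝒜 𝒜] [SMulCommClass K 𝒜 𝒜]

/-- `(𝒜, A, A')` is a quasi-twilled associative algebra: `𝒜 = A ⊕ A'` as vector spaces and `A'`
is a subalgebra of the (not necessarily unital) associative algebra `𝒜`. -/
structure IsQuasiTwilled (A A' : Submodule K 𝒜) : Prop where
  isCompl : IsCompl A A'
  mul_mem : ∀ u ∈ A', ∀ v ∈ A', u * v ∈ A'

variable {A A' : Submodule K 𝒜}

namespace IsQuasiTwilled

/-- The projection `𝒜 = A ⊕ A' → A`. -/
def fst (h : IsQuasiTwilled A A') : 𝒜 →ₗ[K] A := A.projectionOnto A' h.isCompl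

/-- The projection `𝒜 = A ⊕ A' → A'`. -/
def snd (h : IsQuasiTwilled A A') : 𝒜 →ₗ[K] A' := A'.projectionOnto A h.isCompl.symm

/-- The part of the multiplication of `𝒜` that sends `X ⊗ Y` to the target of `q`. -/
def part (X Y : Submodule K 𝒜) {Z : Submodule K 𝒜} (q : 𝒜 →ₗ[K] Z) : X →ₗ[K] Y →ₗ[K] Z :=
  ((LinearMap.mul K 𝒜).compl₁₂ X.subtype Y.subtype).compr₂ q

/-- `π : A ⊗ A → A`. -/
def mapπ (h : IsQuasiTwilled A A') : A →ₗ[K] A →ₗ[K] A := part A A h.fst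
/-- `ξ : A ⊗ A' → A`. -/
def mapξ (h : IsQuasiTwilled A A') : A →ₗ[K] A' →ₗ[K] A := part A A' h.fst
/-- `η : A' ⊗ A → A`. -/
def mapη (h : IsQuasiTwilled A A') : A' →ₗ[K] A →ₗ[K] A := part A' A h.fst
/-- `β : A' ⊗ A' → A'`. -/
def mapβ (h : IsQuasiTwilled A A') : A' →ₗ[K] A' →ₗ[K] A' := part A' A' h.snd
/-- `ρ : A ⊗ A' → A'`. -/
def mapρ (h : IsQuasiTwilled A A') : A →ₗ[K] A' →ₗ[K] A' := part A A' h.snd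
/-- `μ : A' ⊗ A → A'`. -/
def mapμ (h : IsQuasiTwilled A A') : A' →ₗ[K] A →ₗ[K] A' := part A' A h.snd
/-- `θ : A ⊗ A → A'`. -/
def mapθ (h : IsQuasiTwilled A A') : A →ₗ[K] A →ₗ[K] A' := part A A h.snd

/-- `D : A → A'` is a right deformation map of `(𝒜, A, A')`. -/
def IsRightDeformationMap (h : IsQuasiTwilled A A') (D : A →ₗ[K] A') : Prop :=
  ∀ x y : A, D (h.mapπ x y + h.mapξ x (D y) + h.mapη (D x) y) =
    h.mapρ x (D y) + h.mapμ (D x) y + h.mapβ (D x) (D y) + h.mapθ x y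

end IsQuasiTwilled

/-- A bilinear map on `V` as an element of degree `1` of `⨁_{n ≥ 0} Hom(⊗ⁿ⁺¹ V, V)`. -/
def ofBilin {V : Type*} [AddCommGroup V] [Module K V] (b : V →ₗ[K] V →ₗ[K] V) :
    Cochains K V V :=
  DirectSum.lof K ℕ (Cochain K V V) 1
    (MultilinearMap.mk' (fun x : Fin (1 + 1) → V => b (x 0) (x 1))
      (by
        intro x i a c
        fin_cases i <;> simp)
      (by
        intro x i a c
        fin_cases i <;> simp))

/-- The multiplication `Ω` of `𝒜` as a cochain of degree `1`. -/
def mulCochain (K : Type*) [Field K] (𝒜 : Type*) [NonUnitalRing 𝒜] [Module K 𝒜]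
    [IsScalarTower K 𝒜 𝒜] [SMulCommClass K 𝒜 𝒜] : Cochains K 𝒜 𝒜 :=
  ofBilin (LinearMap.mul K 𝒜)

/-- The lift to `𝒜` of a bilinear map `X ⊗ Y → Z` with `X, Y, Z ∈ {A, A'}`: compose with the
projections `p : 𝒜 → X` and `q : 𝒜 → Y` and the inclusion `Z ⊆ 𝒜`. -/
def liftBilin {X Y Z : Submodule K 𝒜} (p : 𝒜 →ₗ[K] X) (q : 𝒜 →ₗ[K] Y)
    (b : X →ₗ[K] Y →ₗ[K] Z) : Cochains K 𝒜 𝒜 :=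
  ofBilin ((b.compl₁₂ p q).compr₂ Z.subtype)

namespace IsQuasiTwilled

/-- The lift of `π`. -/
def hatπ (h : IsQuasiTwilled A A') : Cochains K 𝒜 𝒜 := liftBilin h.fst h.fst h.mapπ
/-- The lift of `ξ`. -/
def hatξ (h : IsQuasiTwilled A A') : Cochains K 𝒜 𝒜 := liftBilin h.fst h.snd h.mapξ
/-- The lift of `η`. -/
def hatη (h : IsQuasiTwilled A A') : Cochains K 𝒜 𝒜 := liftBilin h.snd h.fst h.mapη
/-- The lift of `β`. -/
def hatβ (h : IsQuasiTwilled A A') : Cochains K 𝒜 𝒜 := liftBilin h.snd h.snd h.mapβ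
/-- The lift of `ρ`. -/
def hatρ (h : IsQuasiTwilled A A') : Cochains K 𝒜 𝒜 := liftBilin h.fst h.snd h.mapρ
/-- The lift of `μ`. -/
def hatμ (h : IsQuasiTwilled A A') : Cochains K 𝒜 𝒜 := liftBilin h.snd h.fst h.mapμ
/-- The lift of `θ`. -/
def hatθ (h : IsQuasiTwilled A A') : Cochains K 𝒜 𝒜 := liftBilin h.fst h.fst h.mapθ

/-- The lift `Hom(⊗ⁿ⁺¹ A, A') → Hom(⊗ⁿ⁺¹ 𝒜, 𝒜)`: the lift of `f` is `f` on `⊗ⁿ⁺¹ A` and `0` on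
all tensor products that involve a factor `A'`. -/
def liftHom (h : IsQuasiTwilled A A') (n : ℕ) : Cochain K A A' n →ₗ[K] Cochain K 𝒜 𝒜 n where
  toFun f := A'.subtype.compMultilinearMap (f.compLinearMap fun _ => h.fst)
  map_add' f g := by ext x; simp
  map_smul' c f := by ext x; simp

/-- The lift `⨁ Hom(⊗ⁿ⁺¹ A, A') → ⨁ Hom(⊗ⁿ⁺¹ 𝒜, 𝒜)`. -/
def lift (h : IsQuasiTwilled A A') : Cochains K A A' →ₗ[K] Cochains K 𝒜 𝒜 :=
  DirectSum.lmap h.liftHom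

/-- The component in `Hom(⊗ⁿ⁺¹ A, A')` of a cochain on `𝒜`: restrict it to `⊗ⁿ⁺¹ A` and project
its values to `A'`. -/
def componentHom (h : IsQuasiTwilled A A') (n : ℕ) :
    Cochain K 𝒜 𝒜 n →ₗ[K] Cochain K A A' n where
  toFun f := h.snd.compMultilinearMap (f.compLinearMap fun _ => A.subtype)
  map_add' f g := by ext x; simp
  map_smul' c f := by ext x; simp

/-- The subspace `F = ⨁ Hom(⊗ⁿ⁺¹ A, A')` of `⨁ Hom(⊗ⁿ⁺¹ 𝒜, 𝒜)`. -/
def F (h : IsQuasiTwilled A A') : Submodule K (Cochains K 𝒜 𝒜) := LinearMap.range h.lift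

/-- The projection `P` of `⨁ Hom(⊗ⁿ⁺¹ 𝒜, 𝒜)` onto `F`, along the sum of all the other components
of the decomposition of `Hom(⊗ⁿ⁺¹ (A ⊕ A'), A ⊕ A')`. -/
def P (h : IsQuasiTwilled A A') : Cochains K 𝒜 𝒜 →ₗ[K] Cochains K 𝒜 𝒜 :=
  h.lift ∘ₗ DirectSum.lmap h.componentHom

/-- The brackets `lₖ` on `F = ⨁ Hom(⊗ⁿ⁺¹ A, A')` derived from the multiplication of `𝒜`. -/
def l (h : IsQuasiTwilled A A') (k : ℕ) : MultilinearMap K (fun _ : Fin k => h.F) h.F :=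
  derivedBracket (gerstenhaber K 𝒜) h.F h.P (fun _ => ⟨_, rfl⟩) (mulCochain K 𝒜) k

/-- The grading of `F`, with `Hom(⊗ⁿ⁺¹ A, A')` in degree `n`. -/
def gradingF (h : IsQuasiTwilled A A') : ℤ → Submodule K h.F :=
  inducedGrading (cochainGrading K 𝒜 𝒜) h.F

/-- A linear map `D : A → A'` as an element of `F`. -/
def toF (h : IsQuasiTwilled A A') (D : A →ₗ[K] A') : h.F :=
  ⟨h.lift (DirectSum.lof K ℕ (Cochain K A A') 0
    (MultilinearMap.ofSubsingleton K A A' (0 : Fin 1) D)), _, rfl⟩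

end IsQuasiTwilled

end QuasiTwilled

end QuasiTwilled

end

/-! Give `A` weight `0` and `A'` weight `1`, and say that a cochain has weight `d` if it raises
total weight by `d`. The Gerstenhaber bracket adds weights (`gerstenhaber_mem_weightSubmodule`).
Arguments have weight at least `0` and values at most `1`, so weight `≥ 2` forces a cochain to
vanish, and weight `1` leaves only maps `⊗ⁿ⁺¹ A → A'`. Thus `F` is the weight `1` part, it is
abelian, and `P` fixes weight `1` and kills every other weight. The kernel of `P` consists of the
cochains preserving `A`, a condition stable under insertion.

As `A'` is a subalgebra, `Ω` has no component `A' ⊗ A' → A` of weight `-2`. It splits into `θ`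
(weight `1`), `π + ρ + μ` (weight `0`) and `ξ + η + β` (weight `-1`). Each bracket with an element
of `F` raises weight by one, and `P` keeps weight `1` only. This gives the formulas for `l₀`, `l₁`,
`l₂`, and shows that three brackets already annihilate `Ω`.

The graded Lie axioms for `L` follow from the pre-Lie identity `circTotal_preLie`. Since `lₖ = 0`
for `k ≥ 3`, the `L∞` relations are nontrivial only for at most three inputs. There they come from
`[Δ, Δ] = 0` through `P[x, y] = P[Px, y] + P[x, Py]` (`proj_bracket`). Finally, the Maurer–Cartan
series of `D` is computed in closed form and is the defect in the deformation equation. -/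

open scoped DirectSum

noncomputable section

namespace QuasiTwilled

/-! ### The Gerstenhaber bracket: pre-Lie identity and graded Lie algebra. -/

section Gerstenhaber

variable {K : Type*} [Field K] {V W : Type*} [AddCommGroup V] [Module K V]
  [AddCommGroup W] [Module K W]

/-- The value of a cochain on the first `n + 1` terms of a sequence. -/
def evalSeq {n : ℕ} (f : Cochain K V W n) (x : ℕ → V) : W := f fun i => x i

theorem evalSeq_congr {n : ℕ} (f : Cochain K V W n) {x y : ℕ → V} (h : ∀ k ≤ n, x k = y k) :
    evalSeq f x = evalSeq f y := by
  unfold evalSeq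
  congr 1
  funext i
  exact h i (by omega)

theorem cochain_ext_seq {n : ℕ} {f g : Cochain K V W n} (h : ∀ x, evalSeq f x = evalSeq g x) :
    f = g := by
  ext x
  -- The padding value `0` is never read.
  have := h fun k => if hk : k < n + 1 then x ⟨k, hk⟩ else 0
  simpa only [evalSeq, Fin.is_lt, dite_true, Fin.eta] using this

/-- Sequences can be fed to a cochain of any arity, so cochains in degrees such as `m + n + p` and
`m + (n + p)` are compared without casts. -/
theorem lof_eq_lof {n n' : ℕ} (hn : n = n') {f : Cochain K V W n} {g : Cochain K V W n'}
    (h : ∀ x, evalSeq f x = evalSeq g x) :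
    DirectSum.lof K ℕ (Cochain K V W) n f = DirectSum.lof K ℕ (Cochain K V W) n' g := by
  subst hn
  rw [cochain_ext_seq h]

theorem evalSeq_add {n : ℕ} (f g : Cochain K V W n) (x : ℕ → V) :
    evalSeq (f + g) x = evalSeq f x + evalSeq g x := rfl

theorem evalSeq_sub {n : ℕ} (f g : Cochain K V W n) (x : ℕ → V) :
    evalSeq (f - g) x = evalSeq f x - evalSeq g x := rfl

theorem evalSeq_smul {n : ℕ} (c : K) (f : Cochain K V W n) (x : ℕ → V) :
    evalSeq (c • f) x = c • evalSeq f x := rfl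

/-- The sequence `x₀, …, x_{i-1}, g(x_i, …, x_{i+n}), x_{i+n+1}, …`. -/
def insertSeq {n : ℕ} (g : Cochain K V V n) (i : ℕ) (x : ℕ → V) : ℕ → V := fun j =>
  if j < i then x j else if j = i then evalSeq g fun k => x (i + k) else x (j + n)

theorem evalSeq_insertAt {m n : ℕ} (f : Cochain K V V m) (g : Cochain K V V n) (i : Fin (m + 1))
    (x : ℕ → V) : evalSeq (insertAt f g i) x = evalSeq f (insertSeq g i x) := by
  unfold evalSeq
  rw [insertAt_apply]
  congr 1
  funext j
  simp only [insertArgs, insertSeq, evalSeq, Fin.lt_def, Fin.ext_iff]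

theorem circ_apply {m n : ℕ} (f : Cochain K V V m) (g : Cochain K V V n) :
    circ m n f g = ∑ i : Fin (m + 1), (-1 : K) ^ ((i : ℕ) * n) • insertAt f g i := rfl

theorem evalSeq_circ {m n : ℕ} (f : Cochain K V V m) (g : Cochain K V V n) (x : ℕ → V) :
    evalSeq (circ m n f g) x =
      ∑ i ∈ Finset.range (m + 1), (-1 : K) ^ (i * n) • evalSeq f (insertSeq g i x) := by
  rw [circ_apply, Finset.sum_range]
  simp only [← evalSeq_insertAt]
  simp [evalSeq]

/-- Multilinearity of `f` in slot `i`: the inserted value enters as an update at `i`, so a linear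
combination there can be pulled out. -/
theorem evalSeq_insertSeq_sum {ι : Type*} {m n : ℕ} (f : Cochain K V V m) (s : Finset ι)
    (c : ι → K) (g : Cochain K V V n) (u : ι → V) (i : ℕ) (hi : i ≤ m) (x : ℕ → V)
    (hg : (evalSeq g fun k => x (i + k)) = ∑ a ∈ s, c a • u a) :
    evalSeq f (insertSeq g i x) =
      ∑ a ∈ s, c a • evalSeq f (fun j => if j < i then x j else if j = i then u a
        else x (j + n)) := by
  have key : ∀ v : V, (fun j : Fin (m + 1) => if (j : ℕ) < i then x j else if (j : ℕ) = i then v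
      else x (j + n)) = Function.update (fun j : Fin (m + 1) => if (j : ℕ) < i then x j
        else x (j + n)) ⟨i, by omega⟩ v := by
    intro v
    funext j
    simp only [Function.update_apply, Fin.ext_iff]
    split_ifs <;> first | rfl | omega
  simp only [evalSeq, insertSeq] at hg ⊢
  simp only [key, hg, MultilinearMap.map_update_sum, MultilinearMap.map_update_smul]

theorem insertSeq_insertSeq_of_nested {n p : ℕ} (g : Cochain K V V n) (h : Cochain K V V p)
    (i k : ℕ) (hk : k ≤ n) (x : ℕ → V) :
    insertSeq g i (insertSeq h (i + k) x) = fun j => if j < i then x j else if j = i then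
      evalSeq g (insertSeq h k fun l => x (i + l)) else x (j + (n + p)) := by
  funext j
  rcases lt_trichotomy j i with hj | hj | hj
  · simp [insertSeq, hj, show j < i + k by omega]
  · subst hj
    simp only [insertSeq, lt_irrefl, if_false, if_true]
    congr 1
    funext l
    simp only [insertSeq, add_lt_add_iff_left, add_right_inj, add_assoc]
  · simp only [insertSeq, if_neg (show ¬ j < i by omega), if_neg (show ¬ j = i by omega),
      if_neg (show ¬ j + n < i + k by omega), if_neg (show ¬ j + n = i + k by omega), add_assoc]

/-- Disjoint insertions commute. Inserting `u` shortens the sequence by `p`, so slot `b` afterwards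
was slot `b + p` before. -/
theorem insertSeq_comm {p q : ℕ} (u : Cochain K V V p) (v : Cochain K V V q) {a b : ℕ}
    (hab : a < b) (x : ℕ → V) :
    insertSeq u a (insertSeq v (b + p) x) = insertSeq v b (insertSeq u a x) := by
  funext j
  rcases lt_trichotomy j a with hj | hj | hj
  · simp [insertSeq, hj, show j < b by omega, show j < b + p by omega]
  · subst hj
    simp only [insertSeq, lt_irrefl, if_false, if_true, if_pos hab]
    exact evalSeq_congr _ fun k hk => by simp [show j + k < b + p by omega]
  · simp only [insertSeq, if_neg (show ¬ j < a by omega), if_neg (show ¬ j = a by omega),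
      add_lt_add_iff_right, add_left_inj]
    split_ifs with h1 h2
    · rfl
    · refine evalSeq_congr _ fun k _ => ?_
      rw [if_neg (by omega), if_neg (by omega)]
      congr 1
      omega
    · omega
    · omega
    · congr 1
      omega

theorem sum_range_split {M : Type*} [AddCommMonoid M] (φ : ℕ → M) {i m : ℕ} (n : ℕ)
    (hi : i ≤ m) :
    ∑ j ∈ Finset.range (m + n + 1), φ j = ∑ j ∈ Finset.range i, φ j +
      ∑ k ∈ Finset.range (n + 1), φ (i + k) + ∑ b ∈ Finset.Ico (i + 1) (m + 1), φ (b + n) := by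
  obtain ⟨r, rfl⟩ := Nat.exists_eq_add_of_le hi
  rw [show i + r + n + 1 = i + (n + 1) + r by omega, Finset.sum_range_add, Finset.sum_range_add,
    Finset.sum_Ico_eq_sum_range, show i + r + 1 - (i + 1) = r by omega]
  congr 1
  refine Finset.sum_congr rfl fun k _ => ?_
  congr 1
  omega

/-- The sum of all `± f(…, u(…), …, v(…), …)`, with `u` to the left of `v`. -/
def insertTwo {m p q : ℕ} (f : Cochain K V V m) (u : Cochain K V V p) (v : Cochain K V V q)
    (x : ℕ → V) : V :=
  ∑ b ∈ Finset.range (m + 1), ∑ a ∈ Finset.range b,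
    (-1 : K) ^ (a * p + b * q) • evalSeq f (insertSeq v b (insertSeq u a x))

/-- In `(f ∘ g) ∘ h` the input position of `h` lies left of the block consumed by `g`, inside it, or
right of it. The inside terms form `f ∘ (g ∘ h)`; the other two families are the associator. -/
theorem evalSeq_circ_circ {m n p : ℕ} (f : Cochain K V V m) (g : Cochain K V V n)
    (h : Cochain K V V p) (x : ℕ → V) :
    evalSeq (circ (m + n) p (circ m n f g) h) x =
      evalSeq (circ m (n + p) f (circ n p g h)) x +
        (insertTwo f h g x + (-1 : K) ^ (n * p) • insertTwo f g h x) := by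
  have hL : evalSeq (circ (m + n) p (circ m n f g) h) x =
      ∑ i ∈ Finset.range (m + 1), ∑ j ∈ Finset.range (m + n + 1),
        (-1 : K) ^ (j * p + i * n) • evalSeq f (insertSeq g i (insertSeq h j x)) := by
    rw [evalSeq_circ, Finset.sum_comm]
    refine Finset.sum_congr rfl fun j _ => ?_
    rw [evalSeq_circ, Finset.smul_sum]
    simp only [smul_smul, pow_add]
  have hM : evalSeq (circ m (n + p) f (circ n p g h)) x =
      ∑ i ∈ Finset.range (m + 1), ∑ k ∈ Finset.range (n + 1),
        (-1 : K) ^ ((i + k) * p + i * n) •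
          evalSeq f (insertSeq g i (insertSeq h (i + k) x)) := by
    rw [evalSeq_circ]
    refine Finset.sum_congr rfl fun i hi => ?_
    rw [evalSeq_insertSeq_sum f _ _ _ _ i (by simpa [Nat.lt_succ_iff] using hi) x
      (evalSeq_circ g h _), Finset.smul_sum]
    refine Finset.sum_congr rfl fun k hk => ?_
    rw [insertSeq_insertSeq_of_nested g h i k (by simpa [Nat.lt_succ_iff] using hk), smul_smul,
      ← pow_add]
    congr 2
    ring
  -- When `h` lies right of `g`, its position is `b + n` before `g` is inserted and `b` after; the
  -- shift `n` accounts for the sign `(-1)^{np}`.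
  have hR : (-1 : K) ^ (n * p) • insertTwo f g h x =
      ∑ i ∈ Finset.range (m + 1), ∑ b ∈ Finset.Ico (i + 1) (m + 1),
        (-1 : K) ^ ((b + n) * p + i * n) •
          evalSeq f (insertSeq g i (insertSeq h (b + n) x)) := by
    rw [insertTwo, Finset.smul_sum, Finset.sum_comm' (t' := Finset.range (m + 1))
      (s' := fun b => Finset.range b) (by intro a b; simp; omega)]
    refine Finset.sum_congr rfl fun b _ => ?_
    rw [Finset.smul_sum]
    refine Finset.sum_congr rfl fun a ha => ?_
    rw [insertSeq_comm g h (by simpa using ha), smul_smul, ← pow_add]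
    congr 2
    ring
  rw [hL, hM, hR, insertTwo, ← Finset.sum_add_distrib, ← Finset.sum_add_distrib]
  refine Finset.sum_congr rfl fun i hi => ?_
  rw [sum_range_split _ n (show i ≤ m by simpa [Nat.lt_succ_iff] using hi), add_comm (Finset.sum _ _)
    (Finset.sum _ _), add_assoc]

variable (K V) in
/-- The total composition product on `⨁_{n ≥ 0} Hom(⊗ⁿ⁺¹ V, V)`. -/
def circTotal : Cochains K V V →ₗ[K] Cochains K V V →ₗ[K] Cochains K V V :=
  DirectSum.toModule K ℕ _ fun m =>
    (DirectSum.toModule K ℕ _ fun n =>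
      ((circ m n).compr₂ (DirectSum.lof K ℕ (Cochain K V V) (m + n))).flip).flip

theorem circTotal_lof {m n : ℕ} (f : Cochain K V V m) (g : Cochain K V V n) :
    circTotal K V (DirectSum.lof K ℕ (Cochain K V V) m f)
      (DirectSum.lof K ℕ (Cochain K V V) n g) =
        DirectSum.lof K ℕ (Cochain K V V) (m + n) (circ m n f g) := by
  simp [circTotal, DirectSum.toModule_lof]

theorem gerstenhaber_lof {m n : ℕ} (f : Cochain K V V m) (g : Cochain K V V n) :
    gerstenhaber K V (DirectSum.lof K ℕ (Cochain K V V) m f)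
      (DirectSum.lof K ℕ (Cochain K V V) n g) =
        DirectSum.lof K ℕ (Cochain K V V) (m + n) (circ m n f g) -
          (-1 : K) ^ (m * n) • DirectSum.lof K ℕ (Cochain K V V) (n + m) (circ n m g f) := by
  simp [gerstenhaber, DirectSum.toModule_lof, bracketHom]

/-- The associator is a sum over disjoint insertions of `g` and `h` into `f`, hence symmetric in
them up to the Koszul sign. -/
theorem circTotal_preLie {m n p : ℕ} (f : Cochain K V V m) (g : Cochain K V V n)
    (h : Cochain K V V p) :
    let F := DirectSum.lof K ℕ (Cochain K V V) m f
    let G := DirectSum.lof K ℕ (Cochain K V V) n g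
    let H := DirectSum.lof K ℕ (Cochain K V V) p h
    circTotal K V (circTotal K V F G) H - circTotal K V F (circTotal K V G H) =
      (-1 : K) ^ (n * p) • (circTotal K V (circTotal K V F H) G -
        circTotal K V F (circTotal K V H G)) := by
  intro F G H
  have e : ∀ {n p : ℕ} (g : Cochain K V V n) (h : Cochain K V V p),
      circTotal K V (circTotal K V F (DirectSum.lof K ℕ (Cochain K V V) n g))
        (DirectSum.lof K ℕ (Cochain K V V) p h) -
      circTotal K V F (circTotal K V (DirectSum.lof K ℕ (Cochain K V V) n g)
        (DirectSum.lof K ℕ (Cochain K V V) p h)) =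
      DirectSum.lof K ℕ (Cochain K V V) (m + n + p) (circ (m + n) p (circ m n f g) h -
        (circ m (n + p) f (circ n p g h)).domDomCongr (finCongr (by omega))) := by
    intro n p g h
    simp only [F, circTotal_lof, map_sub]
    congr 1
    exact lof_eq_lof (by omega) fun x => rfl
  rw [e, e, ← map_smul]
  refine lof_eq_lof (by omega) fun x => ?_
  have c : ∀ {n p : ℕ} (g : Cochain K V V n) (h : Cochain K V V p),
      evalSeq (circ (m + n) p (circ m n f g) h -
        (circ m (n + p) f (circ n p g h)).domDomCongr (finCongr (by omega))) x =
      insertTwo f h g x + (-1 : K) ^ (n * p) • insertTwo f g h x := by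
    intro n p g h
    rw [evalSeq_sub, evalSeq_circ_circ, sub_eq_iff_eq_add, add_comm]
    rfl
  rw [evalSeq_smul, c, c, smul_add, smul_smul, mul_comm p n, ← mul_pow]
  simp [add_comm]

theorem lof_mem_cochainGrading {n : ℕ} (f : Cochain K V W n) :
    DirectSum.lof K ℕ (Cochain K V W) n f ∈ cochainGrading K V W n := ⟨f, rfl⟩

theorem exists_lof_of_mem_cochainGrading {i : ℤ} {x : Cochains K V W}
    (hx : x ∈ cochainGrading K V W i) :
    x = 0 ∨ ∃ (n : ℕ) (f : Cochain K V W n), i = n ∧ x = DirectSum.lof K ℕ (Cochain K V W) n f := by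
  cases i with
  | ofNat n => exact Or.inr ⟨n, hx.choose, rfl, hx.choose_spec.symm⟩
  | negSucc n => exact Or.inl (by simpa [cochainGrading] using hx)

variable (K V W) in
theorem cochainGrading_isInternal : DirectSum.IsInternal (cochainGrading K V W) := by
  rw [DirectSum.isInternal_submodule_iff_iSupIndep_and_iSup_eq_top]
  constructor
  · intro i
    cases i with
    | negSucc n => exact disjoint_bot_left
    | ofNat n =>
      have hle : (⨆ j, ⨆ (_ : j ≠ Int.ofNat n), cochainGrading K V W j) ≤
          LinearMap.ker (DirectSum.component K ℕ (Cochain K V W) n) := by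
        refine iSup₂_le fun j hj x hx => ?_
        rcases exists_lof_of_mem_cochainGrading hx with rfl | ⟨k, f, rfl, rfl⟩
        · exact zero_mem _
        · rw [LinearMap.mem_ker, DirectSum.component.of, dif_neg]
          rintro rfl
          exact hj rfl
      rw [Submodule.disjoint_def]
      rintro x ⟨f, rfl⟩ hx
      have := hle hx
      rw [LinearMap.mem_ker, DirectSum.component.lof_self] at this
      rw [this, map_zero]
  · rw [eq_top_iff]
    rintro x -
    induction x using DirectSum.induction_on with
    | zero => exact zero_mem _
    | of n f => exact Submodule.mem_iSup_of_mem (n : ℤ) (lof_mem_cochainGrading f)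
    | add x y hx hy => exact add_mem hx hy

theorem negOnePow_natCast_smul {M : Type*} [AddCommGroup M] [Module K M] (a : ℕ) (x : M) :
    (a : ℤ).negOnePow • x = (-1 : K) ^ a • x := by
  rcases Nat.even_or_odd a with h | h
  · rw [Int.negOnePow_even _ (by exact_mod_cast h), h.neg_one_pow, one_smul, one_smul]
  · rw [Int.negOnePow_odd _ (by exact_mod_cast h), h.neg_one_pow, neg_smul, one_smul, Units.neg_smul,
      one_smul]

theorem gerstenhaber_eq_circTotal {m n : ℕ} (f : Cochain K V V m) (g : Cochain K V V n) :
    gerstenhaber K V (DirectSum.lof K ℕ (Cochain K V V) m f)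
      (DirectSum.lof K ℕ (Cochain K V V) n g) =
        circTotal K V (DirectSum.lof K ℕ (Cochain K V V) m f)
          (DirectSum.lof K ℕ (Cochain K V V) n g) -
        (-1 : K) ^ (m * n) • circTotal K V (DirectSum.lof K ℕ (Cochain K V V) n g)
          (DirectSum.lof K ℕ (Cochain K V V) m f) := by
  rw [gerstenhaber_lof, circTotal_lof, circTotal_lof]

theorem exists_gerstenhaber_lof {m n : ℕ} (f : Cochain K V V m) (g : Cochain K V V n) :
    ∃ w : Cochain K V V (m + n), gerstenhaber K V (DirectSum.lof K ℕ (Cochain K V V) m f)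
      (DirectSum.lof K ℕ (Cochain K V V) n g) = DirectSum.lof K ℕ (Cochain K V V) (m + n) w := by
  refine ⟨circ m n f g - (-1 : K) ^ (m * n) • (circ n m g f).domDomCongr
    (finCongr (by omega)), ?_⟩
  rw [gerstenhaber_lof, map_sub, map_smul]
  congr 2
  exact lof_eq_lof (by omega) fun x => rfl

variable (K V) in
-- The graded commutator of a graded pre-Lie product is a Lie bracket: Jacobi is a signed sum of
-- three pre-Lie identities, one for each element placed outermost.
theorem gerstenhaber_isGradedLieAlgebra :
    IsGradedLieAlgebra (cochainGrading K V V) (gerstenhaber K V) where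
  internal := cochainGrading_isInternal K V V
  degree i j x y hx hy := by
    rcases exists_lof_of_mem_cochainGrading hx with rfl | ⟨m, f, rfl, rfl⟩
    · simp
    rcases exists_lof_of_mem_cochainGrading hy with rfl | ⟨n, g, rfl, rfl⟩
    · simp
    obtain ⟨w, hw⟩ := exists_gerstenhaber_lof f g
    rw [hw]
    exact_mod_cast lof_mem_cochainGrading w
  skew i j x y hx hy := by
    rcases exists_lof_of_mem_cochainGrading hx with rfl | ⟨m, f, rfl, rfl⟩
    · simp
    rcases exists_lof_of_mem_cochainGrading hy with rfl | ⟨n, g, rfl, rfl⟩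
    · simp
    rw [← Nat.cast_mul, negOnePow_natCast_smul (K := K), gerstenhaber_eq_circTotal,
      gerstenhaber_eq_circTotal, mul_comm n m, smul_sub, smul_smul, ← mul_pow]
    simp
  jacobi i j k x y z hx hy hz := by
    rcases exists_lof_of_mem_cochainGrading hx with rfl | ⟨m, f, rfl, rfl⟩
    · simp
    rcases exists_lof_of_mem_cochainGrading hy with rfl | ⟨n, g, rfl, rfl⟩
    · simp
    rcases exists_lof_of_mem_cochainGrading hz with rfl | ⟨p, h, rfl, rfl⟩
    · simp
    have h1 := circTotal_preLie f g h
    have h2 := circTotal_preLie g f h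
    have h3 := circTotal_preLie h f g
    -- The inner brackets are named as homogeneous elements only so that the outer ones can be
    -- expanded; they are then unfolded again.
    obtain ⟨u, hu⟩ := exists_gerstenhaber_lof g h
    obtain ⟨v, hv⟩ := exists_gerstenhaber_lof f g
    obtain ⟨w, hw⟩ := exists_gerstenhaber_lof f h
    rw [← Nat.cast_mul, negOnePow_natCast_smul (K := K), hu, hv, hw, gerstenhaber_eq_circTotal,
      gerstenhaber_eq_circTotal, gerstenhaber_eq_circTotal, ← hu, ← hv, ← hw]
    simp only [gerstenhaber_eq_circTotal, map_sub, map_smul, LinearMap.sub_apply,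
      LinearMap.smul_apply, add_mul, mul_add, pow_add]
    dsimp only at h1 h2 h3
    rw [mul_comm n m]
    generalize circTotal K V = C at *
    generalize DirectSum.lof K ℕ (Cochain K V V) m f = x at *
    generalize DirectSum.lof K ℕ (Cochain K V V) n g = y at *
    generalize DirectSum.lof K ℕ (Cochain K V V) p h = z at *
    rcases neg_one_pow_eq_or K (m * n) with e1 | e1 <;>
    rcases neg_one_pow_eq_or K (m * p) with e2 | e2 <;>
    rcases neg_one_pow_eq_or K (n * p) with e3 | e3 <;>
    · linear_combination (norm := skip) (-1 : K) • h1 + (-1 : K) ^ (m * n) • h2 -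
        ((-1 : K) ^ (m * p)) • ((-1 : K) ^ (n * p)) • h3
      simp only [e1, e2, e3]
      module

end Gerstenhaber

/-! ### Curved `L∞`-relations from derived brackets, when triple brackets vanish. -/

section General

variable {K : Type*} [Field K] {L : Type*} [AddCommGroup L] [Module K L]

theorem iteratedBracket_succ (br : L →ₗ[K] L →ₗ[K] L) (Δ : L) (k : ℕ) (v : Fin (k + 1) → L) :
    iteratedBracket br Δ (k + 1) v =
      br (iteratedBracket br Δ k fun a => v a.castSucc) (v (Fin.last k)) := rfl

theorem coe_derivedBracket (br : L →ₗ[K] L →ₗ[K] L) (F : Submodule K L) (P : L →ₗ[K] L)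
    (hP : ∀ x, P x ∈ F) (Δ : L) (k : ℕ) (v : Fin k → F) :
    (derivedBracket br F P hP Δ k v : L) = P (iteratedBracket br Δ k fun a => v a) := rfl

/-- Independence is inherited from `𝒢`; spanning is the field `graded` of the subalgebra. -/
theorem inducedGrading_isInternal {𝒢 : ℤ → Submodule K L} {br : L →ₗ[K] L →ₗ[K] L}
    {F : Submodule K L} (h : DirectSum.IsInternal 𝒢) (hF : IsGradedLieSubalgebra 𝒢 br F) :
    DirectSum.IsInternal (inducedGrading 𝒢 F) := by
  rw [DirectSum.isInternal_submodule_iff_iSupIndep_and_iSup_eq_top] at h ⊢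
  constructor
  · intro i
    rw [Submodule.disjoint_def]
    intro x hx hx'
    have hd := Submodule.disjoint_def.1 (h.1 i) x hx
    refine Subtype.ext (hd ?_)
    have : (⨆ j, ⨆ (_ : j ≠ i), inducedGrading 𝒢 F j) ≤
        (⨆ j, ⨆ (_ : j ≠ i), 𝒢 j).comap F.subtype :=
      iSup₂_le fun j hj => Submodule.comap_mono (le_iSup₂_of_le j hj le_rfl)
    exact this hx'
  · rw [← (Submodule.map_injective_of_injective F.injective_subtype).eq_iff, Submodule.map_iSup,
      Submodule.map_top, Submodule.range_subtype]
    conv_rhs => rw [hF.graded]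
    refine iSup_congr fun i => ?_
    rw [inducedGrading, Submodule.map_comap_eq, Submodule.range_subtype]

variable {𝒢 : ℤ → Submodule K L} {br : L →ₗ[K] L →ₗ[K] L} {F : Submodule K L} {P : L →ₗ[K] L}
  {Δ : L}

namespace IsCurvedVData

theorem proj_mem (H : IsCurvedVData 𝒢 br F P Δ) (x : L) : P x ∈ F := by
  rw [← H.range_proj]
  exact ⟨x, rfl⟩

/-- Expand `P[x - Px, y - Py] = 0`, which holds because the kernel of `P` is a subalgebra; `[Px,
Py]` drops out because `F` is abelian. -/
theorem proj_bracket (H : IsCurvedVData 𝒢 br F P Δ) (x y : L) :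
    P (br x y) = P (br (P x) y) + P (br x (P y)) := by
  have hk : ∀ z, z - P z ∈ LinearMap.ker P := fun z => by
    rw [LinearMap.mem_ker, map_sub, ← LinearMap.comp_apply P P, H.proj, sub_self]
  have h := H.ker_proj.closed _ (hk x) _ (hk y)
  rw [LinearMap.mem_ker] at h
  simp only [map_sub, LinearMap.sub_apply, H.abelian _ (H.proj_mem x) _ (H.proj_mem y), sub_zero] at h
  rw [← sub_eq_zero, ← h]
  abel

theorem bracket_bracket_delta (H : IsCurvedVData 𝒢 br F P Δ) {i j : ℤ} {x y : L} (hx : x ∈ F)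
    (hy : y ∈ F) (hxi : x ∈ 𝒢 i) (hyj : y ∈ 𝒢 j) :
    br x (br Δ y) = -(i.negOnePow • br (br Δ x) y) := by
  have h := H.gradedLie.jacobi _ _ _ _ _ _ H.degree_one hxi hyj
  rw [H.abelian x hx y hy, map_zero, one_mul] at h
  rcases Int.units_eq_one_or i.negOnePow with e | e <;>
    simp only [e, one_smul, Units.neg_smul, neg_neg] at h ⊢
  · exact (neg_eq_of_add_eq_zero_right h.symm).symm
  · exact (add_neg_eq_zero.1 h.symm).symm

/-- Graded symmetry of `l₂`, valid already before `P` is applied: Jacobi with `[x, y] = 0`. -/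
theorem bracket_delta_comm (H : IsCurvedVData 𝒢 br F P Δ) {i j : ℤ} {x y : L} (hx : x ∈ F)
    (hy : y ∈ F) (hxi : x ∈ 𝒢 i) (hyj : y ∈ 𝒢 j) :
    br (br Δ x) y = (i * j).negOnePow • br (br Δ y) x := by
  rw [H.gradedLie.skew _ _ _ _ (H.gradedLie.degree _ _ _ _ H.degree_one hxi) hyj,
    H.bracket_bracket_delta hy hx hyj hxi, add_mul, one_mul, Int.negOnePow_add, smul_neg, neg_neg,
    smul_smul]
  congr 1
  rcases Int.units_eq_one_or j.negOnePow with e | e <;> simp [e]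

/-- Bracketing from the left by an element of `F` commutes with bracketing from the right. -/
theorem bracket_bracket_of_mem (H : IsCurvedVData 𝒢 br F P Δ) {i j k : ℤ} {x y u : L} (hx : x ∈ F)
    (hy : y ∈ F) (hxi : x ∈ 𝒢 i) (hyj : y ∈ 𝒢 j) (hu : u ∈ 𝒢 k) :
    br x (br u y) = br (br x u) y := by
  rw [H.gradedLie.jacobi _ _ _ _ _ _ hxi hu hyj, H.abelian x hx y hy, map_zero, smul_zero, add_zero]

/-- As `Δ` is odd, Jacobi with `[Δ, Δ] = 0` says only that the element is its own negative, whence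
characteristic not `2`. -/
theorem delta_bracket_delta (H : IsCurvedVData 𝒢 br F P Δ) (hK : (2 : K) ≠ 0) {i : ℤ} {x : L}
    (hx : x ∈ 𝒢 i) : br Δ (br Δ x) = 0 := by
  have h := H.gradedLie.jacobi _ _ _ _ _ _ H.degree_one H.degree_one hx
  rw [H.square_zero, map_zero, LinearMap.zero_apply, zero_add, one_mul, Int.negOnePow_one,
    Units.neg_smul, one_smul] at h
  have h2 : (2 : K) • br Δ (br Δ x) = 0 := by
    rw [two_smul]
    exact add_eq_zero_iff_eq_neg.2 h
  exact (smul_eq_zero.1 h2).resolve_left hK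

/-- Projecting `[Δ, Δ] = 0` by `proj_bracket` gives two terms, equal because both entries have
degree `1`. -/
theorem jacobi_zero (H : IsCurvedVData 𝒢 br F P Δ) (hK : (2 : K) ≠ 0)
    (hdeg : ∀ i, ∀ x ∈ 𝒢 i, P x ∈ 𝒢 i) : P (br Δ (P Δ)) = 0 := by
  have h := H.proj_bracket Δ Δ
  have hs := H.gradedLie.skew 1 1 (P Δ) Δ (hdeg _ _ H.degree_one) H.degree_one
  rw [one_mul, Int.negOnePow_one, Units.neg_smul, one_smul, neg_neg] at hs
  rw [H.square_zero, map_zero, hs, ← two_smul K] at h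
  exact (smul_eq_zero.1 h.symm).resolve_left hK

theorem jacobi_one (H : IsCurvedVData 𝒢 br F P Δ) (hK : (2 : K) ≠ 0)
    (hdeg : ∀ i, ∀ x ∈ 𝒢 i, P x ∈ 𝒢 i)
    {i : ℤ} {x : L} (hx : x ∈ F) (hxi : x ∈ 𝒢 i) :
    P (br (br Δ (P Δ)) x) + P (br Δ (P (br Δ x))) = 0 := by
  have h := H.proj_bracket Δ (br Δ x)
  rw [H.delta_bracket_delta hK hxi, map_zero, H.bracket_bracket_delta (H.proj_mem Δ) hx
    (hdeg _ _ H.degree_one) hxi, Int.negOnePow_one, Units.neg_smul, one_smul, neg_neg] at h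
  exact h.symm

theorem delta_bracket_bracket (H : IsCurvedVData 𝒢 br F P Δ) (hK : (2 : K) ≠ 0)
    {i j : ℤ} {x y : L} (hxi : x ∈ 𝒢 i) (hyj : y ∈ 𝒢 j) :
    br Δ (br (br Δ x) y) = -(i.negOnePow • br (br Δ x) (br Δ y)) := by
  rw [H.gradedLie.jacobi _ _ _ _ _ _ H.degree_one
    (H.gradedLie.degree _ _ _ _ H.degree_one hxi) hyj, H.delta_bracket_delta hK hxi, map_zero,
    LinearMap.zero_apply, zero_add, one_mul, Int.negOnePow_add, Int.negOnePow_one, neg_one_mul,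
    Units.neg_smul]

/-- Since `F` is abelian, `u` can be moved inwards until it meets `Δ`; the result is a triple
bracket of `Δ` up to sign. -/
theorem bracket_triple (H : IsCurvedVData 𝒢 br F P Δ)
    (h3 : ∀ x ∈ F, ∀ y ∈ F, ∀ z ∈ F, br (br (br Δ x) y) z = 0)
    {i j k : ℤ} {u x y : L} (hu : u ∈ F) (hx : x ∈ F) (hy : y ∈ F)
    (hui : u ∈ 𝒢 i) (hxj : x ∈ 𝒢 j) (hyk : y ∈ 𝒢 k) : br u (br (br Δ x) y) = 0 := by
  rw [H.bracket_bracket_of_mem hu hy hui hyk (H.gradedLie.degree _ _ _ _ H.degree_one hxj),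
    H.bracket_bracket_delta hu hx hui hxj, map_neg, Units.smul_def, map_zsmul, LinearMap.neg_apply,
    LinearMap.smul_apply, h3 u hu x hx y hy, smul_zero, neg_zero]

/-- Apply `P` to `[Δ, [[Δ, x], y]] = ±[[Δ, x], [Δ, y]]` and use `proj_bracket` on each side. The
term with `PΔ`, which would be `l₃(l₀, x, y)`, vanishes by `bracket_triple`. -/
theorem jacobi_two (H : IsCurvedVData 𝒢 br F P Δ) (hK : (2 : K) ≠ 0)
    (hdeg : ∀ i, ∀ x ∈ 𝒢 i, P x ∈ 𝒢 i) (h3 : ∀ x ∈ F, ∀ y ∈ F, ∀ z ∈ F, br (br (br Δ x) y) z = 0)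
    {i j : ℤ} {x y : L} (hx : x ∈ F) (hy : y ∈ F) (hxi : x ∈ 𝒢 i) (hyj : y ∈ 𝒢 j) :
    P (br (br Δ (P (br Δ x))) y) + (i * j).negOnePow • P (br (br Δ (P (br Δ y))) x) +
      P (br Δ (P (br (br Δ x) y))) = 0 := by
  have hX := hdeg _ _ (H.gradedLie.degree _ _ _ _ H.degree_one hxi)
  have hY := hdeg _ _ (H.gradedLie.degree _ _ _ _ H.degree_one hyj)
  have h := H.proj_bracket Δ (br (br Δ x) y)
  rw [H.bracket_triple h3 (H.proj_mem Δ) hx hy (hdeg _ _ H.degree_one) hxi hyj, map_zero, zero_add,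
    H.delta_bracket_bracket hK hxi hyj] at h
  rw [← h, map_neg, Units.smul_def i.negOnePow, map_zsmul, H.proj_bracket (br Δ x) (br Δ y),
    H.bracket_bracket_delta (H.proj_mem _) hy hX hyj,
    H.bracket_delta_comm hx (H.proj_mem _) hxi hY]
  simp only [map_neg, Units.smul_def, map_zsmul]
  simp only [← Units.smul_def, mul_add, mul_one, Int.negOnePow_add, Int.negOnePow_one]
  rcases Int.units_eq_one_or i.negOnePow with e | e <;>
    rcases Int.units_eq_one_or (i * j).negOnePow with e' | e' <;>
    simp only [e, e', one_smul, Units.neg_smul, mul_one, mul_neg, neg_neg] <;>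
    abel

theorem proj_bracket_delta_triple (H : IsCurvedVData 𝒢 br F P Δ)
    (h3 : ∀ x ∈ F, ∀ y ∈ F, ∀ z ∈ F, br (br (br Δ x) y) z = 0)
    {i j k : ℤ} {x y z : L} (hx : x ∈ F) (hy : y ∈ F) (hz : z ∈ F)
    (hdeg : ∀ i, ∀ x ∈ 𝒢 i, P x ∈ 𝒢 i)
    (hxi : x ∈ 𝒢 i) (hyj : y ∈ 𝒢 j) (hzk : z ∈ 𝒢 k) :
    P (br (br Δ x) (br (br Δ y) z)) =
      (i * (1 + j + k)).negOnePow • P (br (br Δ (P (br (br Δ y) z))) x) := by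
  have hX := H.gradedLie.degree _ _ _ _ H.degree_one hxi
  have hYz := H.gradedLie.degree _ _ _ _ (H.gradedLie.degree _ _ _ _ H.degree_one hyj) hzk
  rw [H.proj_bracket, H.bracket_triple h3 (H.proj_mem _) hy hz (hdeg _ _ hX) hyj hzk, map_zero,
    zero_add, H.bracket_delta_comm hx (H.proj_mem _) hxi (hdeg _ _ hYz), Units.smul_def, map_zsmul,
    ← Units.smul_def]

/-- Compute `P[[[Δ, x], [Δ, y]], z]` twice and eliminate it: `h1` applies Jacobi to the vanishing
`[Δ, [[[Δ, x], y], z]]`, and `h2` applies it to `[[Δ, x], [[Δ, y], z]]`. -/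
theorem jacobi_three (H : IsCurvedVData 𝒢 br F P Δ) (hK : (2 : K) ≠ 0)
    (hdeg : ∀ i, ∀ x ∈ 𝒢 i, P x ∈ 𝒢 i) (h3 : ∀ x ∈ F, ∀ y ∈ F, ∀ z ∈ F, br (br (br Δ x) y) z = 0)
    {i j k : ℤ} {x y z : L} (hx : x ∈ F) (hy : y ∈ F) (hz : z ∈ F)
    (hxi : x ∈ 𝒢 i) (hyj : y ∈ 𝒢 j) (hzk : z ∈ 𝒢 k) :
    P (br (br Δ (P (br (br Δ x) y))) z) +
      (j * k).negOnePow • P (br (br Δ (P (br (br Δ x) z))) y) +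
      (i * j + i * k).negOnePow • P (br (br Δ (P (br (br Δ y) z))) x) = 0 := by
  have hX := H.gradedLie.degree _ _ _ _ H.degree_one hxi
  have hY := H.gradedLie.degree _ _ _ _ H.degree_one hyj
  have hXy := H.gradedLie.degree _ _ _ _ hX hyj
  have h1 := congrArg P (H.gradedLie.jacobi _ _ _ _ _ _ H.degree_one hXy hzk)
  have h2 := congrArg P (H.gradedLie.jacobi _ _ _ _ _ _ hX hY hzk)
  rw [h3 x hx y hy z hz, map_zero, map_zero, H.delta_bracket_bracket hK hxi hyj, map_add,
    Units.smul_def (1 * _ : ℤ).negOnePow, map_zsmul, H.proj_bracket _ (br Δ z),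
    h3 x hx y hy _ (H.proj_mem _), map_zero, add_zero,
    H.bracket_bracket_delta (H.proj_mem _) hz (hdeg _ _ hXy) hzk] at h1
  rw [H.proj_bracket_delta_triple h3 hx hy hz hdeg hxi hyj hzk, map_add,
    Units.smul_def ((1 + i) * _ : ℤ).negOnePow, map_zsmul,
    H.proj_bracket_delta_triple h3 hy hx hz hdeg hyj hxi hzk] at h2
  simp only [map_neg, LinearMap.neg_apply, Units.smul_def, map_zsmul, LinearMap.smul_apply] at h1 h2 ⊢
  simp only [← Units.smul_def, mul_add, add_mul, one_mul, mul_one, Int.negOnePow_add,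
    Int.negOnePow_one, mul_comm j i] at h1 h2 ⊢
  generalize P (br (br (br Δ x) (br Δ y)) z) = w at *
  generalize P (br (br Δ (P (br (br Δ x) y))) z) = a at *
  generalize P (br (br Δ (P (br (br Δ x) z))) y) = b at *
  generalize P (br (br Δ (P (br (br Δ y) z))) x) = c at *
  -- The five signs can be treated as independent; for each choice the relation follows linearly
  -- from `h1` and `h2`.
  rcases Int.units_eq_one_or i.negOnePow with e1 | e1 <;>
    rcases Int.units_eq_one_or j.negOnePow with e2 | e2 <;>
    rcases Int.units_eq_one_or (i * j).negOnePow with e3 | e3 <;>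
    rcases Int.units_eq_one_or (i * k).negOnePow with e4 | e4 <;>
    rcases Int.units_eq_one_or (j * k).negOnePow with e5 | e5 <;>
    simp only [e1, e2, e3, e4, e5, one_smul, Units.neg_smul, mul_one, mul_neg, neg_neg] at h1 h2 ⊢ <;>
    grind

end IsCurvedVData

/-- Either the inner bracket or the outer one, of arity `n - i + 1`, has at least three inputs. From
`n = 4` on this covers every `i`. -/
theorem nestedTerm_eq_zero {l : (k : ℕ) → MultilinearMap K (fun _ : Fin k => L) L}
    (hl : ∀ k, 3 ≤ k → l k = 0) {n : ℕ} (i : Fin (n + 1)) (hi : 3 ≤ (i : ℕ) ∨ i + 2 ≤ n)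
    (y : Fin n → L) : nestedTerm l i y = 0 := by
  unfold nestedTerm
  rcases hi with hi | hi
  · refine MultilinearMap.map_coord_zero _ 0 ?_
    rw [Fin.cons_zero, hl _ hi]
    rfl
  · rw [hl _ (by omega)]
    rfl

theorem isShuffle_iff_eq_one {n i : ℕ} (hi : i = 0 ∨ n ≤ i) (σ : Equiv.Perm (Fin n)) :
    IsShuffle i σ ↔ σ = 1 := by
  constructor
  · intro h
    have hm : StrictMono σ := fun a b hab => h a b hab (by omega)
    exact Equiv.ext fun a => congrFun hm.eq_id a
  · rintro rfl a b hab -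
    exact hab

theorem isShuffle_one_of_two (σ : Equiv.Perm (Fin 2)) :
    IsShuffle 1 σ ↔ σ = 1 ∨ σ = Equiv.swap 0 1 := by
  unfold IsShuffle
  revert σ
  decide

theorem isShuffle_two_of_three (σ : Equiv.Perm (Fin 3)) :
    IsShuffle 2 σ ↔ σ = 1 ∨ σ = Equiv.swap 1 2 ∨ σ = finRotate 3 := by
  unfold IsShuffle
  revert σ
  decide

theorem koszulSign_one {n : ℕ} (d : Fin n → ℤ) : koszulSign d 1 = 1 := by
  refine Finset.prod_eq_one fun p hp => ?_
  have := (Finset.mem_filter.1 hp).2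
  exact absurd this.1 (not_lt_of_gt this.2)

theorem koszulSign_swap_two (d : Fin 2 → ℤ) :
    koszulSign d (Equiv.swap 0 1) = (d 0 * d 1).negOnePow := by
  have : ({p : Fin 2 × Fin 2 | p.1 < p.2 ∧ Equiv.swap (0 : Fin 2) 1 p.2 < Equiv.swap (0 : Fin 2) 1
    p.1} : Finset _) = {(0, 1)} := by decide
  rw [koszulSign, this, Finset.prod_singleton, Equiv.swap_apply_left, Equiv.swap_apply_right,
    mul_comm]

theorem koszulSign_swap_three (d : Fin 3 → ℤ) :
    koszulSign d (Equiv.swap 1 2) = (d 1 * d 2).negOnePow := by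
  have : ({p : Fin 3 × Fin 3 | p.1 < p.2 ∧ Equiv.swap (1 : Fin 3) 2 p.2 < Equiv.swap (1 : Fin 3) 2
    p.1} : Finset _) = {(1, 2)} := by decide
  rw [koszulSign, this, Finset.prod_singleton, Equiv.swap_apply_left, Equiv.swap_apply_right,
    mul_comm]

/-- The rotation yields the order `x₁, x₂, x₀`: the first element passes both others. -/
theorem koszulSign_finRotate_three (d : Fin 3 → ℤ) :
    koszulSign d (finRotate 3) = (d 0 * d 1 + d 0 * d 2).negOnePow := by
  have : ({p : Fin 3 × Fin 3 | p.1 < p.2 ∧ finRotate 3 p.2 < finRotate 3 p.1} : Finset _) =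
    {(0, 2), (1, 2)} := by decide
  rw [koszulSign, this, Finset.prod_pair (by decide), ← Int.negOnePow_add]
  congr 1
  change d 1 * d 0 + d 2 * d 0 = _
  ring

open Classical in
theorem sum_shuffle_trivial {M : Type*} [AddCommGroup M] {n i : ℕ} (hi : i = 0 ∨ n ≤ i) (d : Fin n → ℤ)
    (g : Equiv.Perm (Fin n) → M) :
    ∑ σ : Equiv.Perm (Fin n) with IsShuffle i σ, koszulSign d σ • g σ = g 1 := by
  have : ({σ : Equiv.Perm (Fin n) | IsShuffle i σ} : Finset _) = {1} := by
    ext σ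
    simp [isShuffle_iff_eq_one hi]
  rw [this, Finset.sum_singleton, koszulSign_one, one_smul]

open Classical in
theorem sum_shuffle_one_of_two {M : Type*} [AddCommGroup M] (d : Fin 2 → ℤ)
    (g : Equiv.Perm (Fin 2) → M) :
    ∑ σ : Equiv.Perm (Fin 2) with IsShuffle 1 σ, koszulSign d σ • g σ =
      g 1 + (d 0 * d 1).negOnePow • g (Equiv.swap 0 1) := by
  have : ({σ : Equiv.Perm (Fin 2) | IsShuffle 1 σ} : Finset _) = {1, Equiv.swap 0 1} := by
    ext σ
    simp [isShuffle_one_of_two]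
  rw [this, Finset.sum_pair (by decide), koszulSign_one, one_smul, koszulSign_swap_two]

open Classical in
theorem sum_shuffle_two_of_three {M : Type*} [AddCommGroup M] (d : Fin 3 → ℤ)
    (g : Equiv.Perm (Fin 3) → M) :
    ∑ σ : Equiv.Perm (Fin 3) with IsShuffle 2 σ, koszulSign d σ • g σ =
      g 1 + (d 1 * d 2).negOnePow • g (Equiv.swap 1 2) +
        (d 0 * d 1 + d 0 * d 2).negOnePow • g (finRotate 3) := by
  have : ({σ : Equiv.Perm (Fin 3) | IsShuffle 2 σ} : Finset _) =
      {1, Equiv.swap 1 2, finRotate 3} := by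
    ext σ
    simp [isShuffle_two_of_three]
  rw [this, Finset.sum_insert (by decide), Finset.sum_pair (by decide), koszulSign_one, one_smul,
    koszulSign_swap_three, koszulSign_finRotate_three, add_assoc]

theorem iteratedBracket_mem (H : IsGradedLieAlgebra 𝒢 br) (hΔ : Δ ∈ 𝒢 1) :
    ∀ (k : ℕ) (x : Fin k → L) (d : Fin k → ℤ), (∀ a, x a ∈ 𝒢 (d a)) →
      iteratedBracket br Δ k x ∈ 𝒢 (∑ a, d a + 1)
  | 0, x, d, _ => by simpa [iteratedBracket] using hΔ
  | k + 1, x, d, h => by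
    rw [iteratedBracket_succ, Fin.sum_univ_castSucc, add_right_comm]
    exact H.degree _ _ _ _ (iteratedBracket_mem H hΔ k _ _ fun a => h _) (h _)

theorem iteratedBracket_eq_zero
    (h3 : ∀ x ∈ F, ∀ y ∈ F, ∀ z ∈ F, br (br (br Δ x) y) z = 0) (k : ℕ) (v : Fin (3 + k) → F) :
    iteratedBracket br Δ (3 + k) (fun a => (v a : L)) = 0 := by
  induction k with
  | zero => exact h3 _ (v 0).2 _ (v 1).2 _ (v 2).2
  | succ k ih =>
    exact (iteratedBracket_succ br Δ (3 + k) fun a => (v a : L)).trans (by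
      rw [ih fun a => v a.castSucc, map_zero, LinearMap.zero_apply])

/-- If the iterated brackets of `Δ` with three elements of `F` vanish, then so do the derived
brackets of order at least three. -/
theorem derivedBracket_eq_zero (hP : ∀ x, P x ∈ F)
    (h3 : ∀ x ∈ F, ∀ y ∈ F, ∀ z ∈ F, br (br (br Δ x) y) z = 0) (k : ℕ) (hk : 3 ≤ k) :
    derivedBracket br F P hP Δ k = 0 := by
  obtain ⟨r, rfl⟩ := Nat.exists_eq_add_of_le hk
  ext v
  rw [coe_derivedBracket, iteratedBracket_eq_zero h3, map_zero]
  rfl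

/-- A curved V-data for which the iterated brackets of `Δ` with three elements of `F` vanish
induces a curved `L∞`-structure on `F`. -/
theorem IsCurvedVData.isCurvedLInfinity (H : IsCurvedVData 𝒢 br F P Δ) (hK : (2 : K) ≠ 0)
    (hdeg : ∀ i, ∀ x ∈ 𝒢 i, P x ∈ 𝒢 i) (hP : ∀ x, P x ∈ F)
    (h3 : ∀ x ∈ F, ∀ y ∈ F, ∀ z ∈ F, br (br (br Δ x) y) z = 0) :
    IsCurvedLInfinity (inducedGrading 𝒢 F) (derivedBracket br F P hP Δ) where
  internal := inducedGrading_isInternal H.gradedLie.internal H.subalgebra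
  degree k x d hx := hdeg _ _ (iteratedBracket_mem H.gradedLie H.degree_one k _ d hx)
  symm
    | 0, x, d, hx, σ => by
      rw [Subsingleton.elim σ 1, koszulSign_one, one_smul]
      rfl
    | 1, x, d, hx, σ => by
      rw [Subsingleton.elim σ 1, koszulSign_one, one_smul]
      rfl
    | 2, x, d, hx, σ => by
      -- Every permutation of two letters is a `(1, 1)`-shuffle, so this merely enumerates them.
      rcases (isShuffle_one_of_two σ).1 (fun a b _ _ => by omega) with rfl | rfl
      · rw [koszulSign_one, one_smul]
        rfl
      · rw [koszulSign_swap_two, mul_comm]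
        refine Subtype.ext ?_
        have := congrArg P (H.bracket_delta_comm (x 1).2 (x 0).2 (hx 1) (hx 0))
        rw [Units.smul_def, map_zsmul, ← Units.smul_def] at this
        exact this
    | n + 3, x, d, hx, σ => by
      rw [derivedBracket_eq_zero hP h3 _ (by omega)]
      simp
  jacobi
    | 0, x, d, hx => by
      rw [Fin.sum_univ_one, sum_shuffle_trivial (i := ((0 : Fin 1) : ℕ)) (by simp)]
      exact Subtype.ext (H.jacobi_zero hK hdeg)
    | 1, x, d, hx => by
      rw [Fin.sum_univ_two, sum_shuffle_trivial (i := ((0 : Fin 2) : ℕ)) (by simp),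
        sum_shuffle_trivial (i := ((1 : Fin 2) : ℕ)) (by simp)]
      exact Subtype.ext (H.jacobi_one hK hdeg (x 0).2 (hx 0))
    | 2, x, d, hx => by
      have hl := derivedBracket_eq_zero hP h3
      rw [Fin.sum_univ_three, Finset.sum_eq_zero fun σ _ => by
        rw [nestedTerm_eq_zero hl 0 (by simp), smul_zero], zero_add,
        sum_shuffle_trivial (i := ((2 : Fin 3) : ℕ)) (by simp)]
      erw [sum_shuffle_one_of_two]
      exact Subtype.ext (H.jacobi_two hK hdeg h3 (x 0).2 (x 1).2 (hx 0) (hx 1))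
    | 3, x, d, hx => by
      have hl := derivedBracket_eq_zero hP h3
      -- With three inputs only `i = 2`, that is `l₂(l₂(·, ·), ·)`, survives.
      rw [Fin.sum_univ_four, Finset.sum_eq_zero fun σ _ => by
        rw [nestedTerm_eq_zero hl 0 (by simp), smul_zero], zero_add,
        Finset.sum_eq_zero fun σ _ => by
          rw [nestedTerm_eq_zero hl 1 (by simp), smul_zero], zero_add]
      rw [sum_shuffle_trivial (i := ((3 : Fin 4) : ℕ)) (by simp), nestedTerm_eq_zero hl 3 (by simp),
        add_zero]
      erw [sum_shuffle_two_of_three]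
      exact Subtype.ext (H.jacobi_three hK hdeg h3 (x 0).2 (x 1).2 (x 2).2 (hx 0) (hx 1) (hx 2))
    | n + 4, x, d, hx => by
      refine Finset.sum_eq_zero fun i _ => Finset.sum_eq_zero fun σ _ => ?_
      rw [nestedTerm_eq_zero (derivedBracket_eq_zero hP h3) i (by omega), smul_zero]

end General

/-! ### Weights of cochains and their additivity under the bracket. -/

section Weight

variable {K : Type*} [Field K] {V : Type*} [AddCommGroup V] [Module K V]

/-- A cochain has weight `d` with respect to a family `S` of subspaces if it maps
`S t₀ ⊗ ⋯ ⊗ S tₙ` to `S (t₀ + ⋯ + tₙ + d)`. -/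
def HasWeight (S : ℤ → Submodule K V) (d : ℤ) {n : ℕ} (f : Cochain K V V n) : Prop :=
  ∀ (t : ℕ → ℤ) (x : ℕ → V), (∀ k ≤ n, x k ∈ S (t k)) →
    evalSeq f x ∈ S (∑ k ∈ Finset.range (n + 1), t k + d)

theorem HasWeight.apply_mem {S : ℤ → Submodule K V} {d : ℤ} {n : ℕ} {f : Cochain K V V n}
    (hf : HasWeight S d f) (t : Fin (n + 1) → ℤ) (x : Fin (n + 1) → V) (hx : ∀ k, x k ∈ S (t k)) :
    f x ∈ S (∑ k, t k + d) := by
  have h := hf (fun k => if hk : k < n + 1 then t ⟨k, hk⟩ else 0)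
    (fun k => if hk : k < n + 1 then x ⟨k, hk⟩ else 0)
    (fun k hk => by simpa only [Nat.lt_succ_of_le hk, dite_true] using hx ⟨k, by omega⟩)
  rw [Finset.sum_range] at h
  simpa only [evalSeq, Fin.is_lt, dite_true, Fin.eta] using h

theorem HasWeight.insertAt {S : ℤ → Submodule K V} {d e : ℤ} {m n : ℕ} {f : Cochain K V V m}
    {g : Cochain K V V n} (hf : HasWeight S d f) (hg : HasWeight S e g) (i : Fin (m + 1)) :
    HasWeight S (d + e) (insertAt f g i) := by
  intro t x hx
  rw [evalSeq_insertAt]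
  have hg' := hg (fun k => t (i + k)) (fun k => x (i + k)) fun k hk => hx _ (by omega)
  -- The slot filled by `g` carries the weight of its whole input block plus `e`.
  have := hf (fun j => if j < i then t j else if j = i then
    ∑ k ∈ Finset.range (n + 1), t (i + k) + e else t (j + n)) (insertSeq g i x) (by
      intro k hk
      simp only [insertSeq]
      split_ifs with h1 h2
      · exact hx _ (by omega)
      · exact hg'
      · exact hx _ (by omega))
  convert this using 2
  have hi : (i : ℕ) ≤ m := by omega
  -- Block length `0 + 1`: this isolates slot `i` in the weights seen by `f`.
  have split := sum_range_split (fun j => if j < (i : ℕ) then t j else if j = i then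
    ∑ k ∈ Finset.range (n + 1), t (i + k) + e else t (j + n)) 0 hi
  rw [add_zero] at split
  rw [sum_range_split _ n hi, split]
  have e1 : ∀ φ : ℕ → ℤ, ∑ j ∈ Finset.range (i : ℕ), (if j < (i : ℕ) then t j else φ j) =
      ∑ j ∈ Finset.range (i : ℕ), t j :=
    fun φ => Finset.sum_congr rfl fun j hj => if_pos (Finset.mem_range.1 hj)
  have e2 : ∑ b ∈ Finset.Ico ((i : ℕ) + 1) (m + 1), (if b + 0 < (i : ℕ) then t (b + 0) else
      if b + 0 = i then ∑ k ∈ Finset.range (n + 1), t (i + k) + e else t (b + 0 + n)) =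
      ∑ b ∈ Finset.Ico ((i : ℕ) + 1) (m + 1), t (b + n) :=
    Finset.sum_congr rfl fun b hb => by
      have := Finset.mem_Ico.1 hb
      rw [if_neg (by omega), if_neg (by omega), add_zero]
  rw [e1, e2]
  simp
  ring

/-- The span of the homogeneous cochains of weight `d`. -/
def weightSubmodule (S : ℤ → Submodule K V) (d : ℤ) : Submodule K (Cochains K V V) :=
  Submodule.span K {c | ∃ (n : ℕ) (f : Cochain K V V n), HasWeight S d f ∧
    c = DirectSum.lof K ℕ (Cochain K V V) n f}

theorem lof_mem_weightSubmodule {S : ℤ → Submodule K V} {d : ℤ} {n : ℕ} {f : Cochain K V V n}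
    (hf : HasWeight S d f) : DirectSum.lof K ℕ (Cochain K V V) n f ∈ weightSubmodule S d :=
  Submodule.subset_span ⟨n, f, hf, rfl⟩

theorem lof_circ_mem_weightSubmodule {S : ℤ → Submodule K V} {d e : ℤ} {m n : ℕ}
    {f : Cochain K V V m} {g : Cochain K V V n} (hf : HasWeight S d f) (hg : HasWeight S e g) :
    DirectSum.lof K ℕ (Cochain K V V) (m + n) (circ m n f g) ∈ weightSubmodule S (d + e) := by
  rw [circ_apply, map_sum]
  refine sum_mem fun i _ => ?_
  rw [map_smul]
  exact Submodule.smul_mem _ _ (lof_mem_weightSubmodule (hf.insertAt hg i))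

theorem gerstenhaber_mem_weightSubmodule {S : ℤ → Submodule K V} {d e : ℤ} {x y : Cochains K V V}
    (hx : x ∈ weightSubmodule S d) (hy : y ∈ weightSubmodule S e) :
    gerstenhaber K V x y ∈ weightSubmodule S (d + e) := by
  refine LinearMap.BilinMap.apply_apply_mem_of_mem_span _ _ _ _ ?_ _ _ hx hy
  rintro _ ⟨m, f, hf, rfl⟩ _ ⟨n, g, hg, rfl⟩
  rw [gerstenhaber_lof]
  refine sub_mem (lof_circ_mem_weightSubmodule hf hg) (Submodule.smul_mem _ _ ?_)
  rw [add_comm d e]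
  exact lof_circ_mem_weightSubmodule hg hf

theorem weightSubmodule_eq_iSup (S : ℤ → Submodule K V) (d : ℤ) :
    weightSubmodule S d = ⨆ i, weightSubmodule S d ⊓ cochainGrading K V V i := by
  refine le_antisymm ?_ (iSup_le fun i => inf_le_left)
  refine Submodule.span_le.2 ?_
  rintro _ ⟨n, f, hf, rfl⟩
  exact Submodule.mem_iSup_of_mem (n : ℤ) ⟨lof_mem_weightSubmodule hf, lof_mem_cochainGrading f⟩

end Weight

/-! ### Brackets of bilinear maps with linear maps and with themselves. -/

section Bilinear

variable {K : Type*} [Field K] {V : Type*} [AddCommGroup V] [Module K V]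

/-- A bilinear map as a cochain with two arguments. -/
def bilinCochain (b : V →ₗ[K] V →ₗ[K] V) : Cochain K V V 1 :=
  MultilinearMap.mk' (fun x : Fin (1 + 1) → V => b (x 0) (x 1))
    (by
      intro x i a c
      fin_cases i <;> simp)
    (by
      intro x i a c
      fin_cases i <;> simp)

theorem ofBilin_eq_lof (b : V →ₗ[K] V →ₗ[K] V) :
    ofBilin b = DirectSum.lof K ℕ (Cochain K V V) 1 (bilinCochain b) := rfl

theorem evalSeq_bilinCochain (b : V →ₗ[K] V →ₗ[K] V) (x : ℕ → V) :
    evalSeq (bilinCochain b) x = b (x 0) (x 1) := rfl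

theorem ofBilin_add (b c : V →ₗ[K] V →ₗ[K] V) : ofBilin (b + c) = ofBilin b + ofBilin c := by
  simp only [ofBilin_eq_lof, ← map_add]
  exact lof_eq_lof rfl fun x => rfl

theorem ofBilin_smul (a : K) (b : V →ₗ[K] V →ₗ[K] V) : ofBilin (a • b) = a • ofBilin b := by
  simp only [ofBilin_eq_lof, ← map_smul]
  exact lof_eq_lof rfl fun x => rfl

theorem ofBilin_eq_zero_iff (b : V →ₗ[K] V →ₗ[K] V) : ofBilin b = 0 ↔ ∀ x y, b x y = 0 := by
  constructor
  · intro h x y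
    rw [ofBilin_eq_lof, ← map_zero (DirectSum.lof K ℕ (Cochain K V V) 1)] at h
    exact congrArg (fun f : Cochain K V V 1 => f ![x, y]) (DirectSum.of_injective 1 h)
  · intro h
    rw [ofBilin_eq_lof, ← map_zero (DirectSum.lof K ℕ (Cochain K V V) 1)]
    exact lof_eq_lof rfl fun x => h _ _

theorem ofBilin_mem_weightSubmodule {S : ℤ → Submodule K V} {d : ℤ} {b : V →ₗ[K] V →ₗ[K] V}
    (h : ∀ s t x y, x ∈ S s → y ∈ S t → b x y ∈ S (s + t + d)) :
    ofBilin b ∈ weightSubmodule S d := by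
  refine lof_mem_weightSubmodule (f := bilinCochain b) fun t x hx => ?_
  rw [Finset.sum_range_succ, Finset.sum_range_one]
  exact h _ _ _ _ (hx 0 (by omega)) (hx 1 le_rfl)

/-- A linear map as a cochain of degree `0`. -/
def ofLin (e : V →ₗ[K] V) : Cochains K V V :=
  DirectSum.lof K ℕ (Cochain K V V) 0 (MultilinearMap.ofSubsingleton K V V (0 : Fin 1) e)

theorem gerstenhaber_ofBilin_ofLin (b : V →ₗ[K] V →ₗ[K] V) (e : V →ₗ[K] V) :
    gerstenhaber K V (ofBilin b) (ofLin e) = ofBilin (b ∘ₗ e + b.compl₂ e - b.compr₂ e) := by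
  rw [ofBilin_eq_lof, ofLin, gerstenhaber_lof, mul_zero, pow_zero, one_smul, sub_eq_iff_eq_add,
    ofBilin_eq_lof, lof_eq_lof (show 0 + 1 = 1 from rfl)
      (f := circ 0 1 (MultilinearMap.ofSubsingleton K V V (0 : Fin 1) e) (bilinCochain b))
      (g := bilinCochain (b.compr₂ e)), ← map_add]
  · refine lof_eq_lof rfl fun x => ?_
    rw [evalSeq_circ, Finset.sum_range_succ, Finset.sum_range_one, evalSeq_add]
    simp only [evalSeq_bilinCochain]
    simp [insertSeq, evalSeq]
  · intro x
    rw [evalSeq_circ, Finset.sum_range_one]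
    simp [insertSeq, evalSeq, bilinCochain]

/-- `b ∘ b` is the associator of `b`. -/
theorem gerstenhaber_ofBilin_self {b : V →ₗ[K] V →ₗ[K] V}
    (hb : ∀ x y z, b (b x y) z = b x (b y z)) : gerstenhaber K V (ofBilin b) (ofBilin b) = 0 := by
  have : circ 1 1 (bilinCochain b) (bilinCochain b) = 0 := by
    refine cochain_ext_seq fun x => ?_
    rw [evalSeq_circ, Finset.sum_range_succ, Finset.sum_range_one]
    simp [evalSeq_bilinCochain, insertSeq, hb]
    rfl
  rw [ofBilin_eq_lof, gerstenhaber_lof, this]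
  simp

end Bilinear

/-! ### The splitting `A ⊕ A'`, the projection `P` and the curved V-data. -/

section QuasiTwilled

variable {K : Type*} [Field K] {𝒜 : Type*} [NonUnitalRing 𝒜] [Module K 𝒜]
  {A A' : Submodule K 𝒜}

variable (A A') in
/-- The grading of `𝒜 = A ⊕ A'` with `A` in weight `0` and `A'` in weight `1`. -/
def splitting (t : ℤ) : Submodule K 𝒜 := if t = 0 then A else if t = 1 then A' else ⊥

theorem splitting_zero : splitting A A' 0 = A := rfl

theorem splitting_one : splitting A A' 1 = A' := rfl

theorem splitting_eq_bot {t : ℤ} (h0 : t ≠ 0) (h1 : t ≠ 1) : splitting A A' t = ⊥ := by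
  rw [splitting, if_neg h0, if_neg h1]

/-- The lift is nonzero only on inputs of weights `a` and `c`, where it lands in weight `e`. -/
theorem liftBilin_mem_weightSubmodule {X Y Z : Submodule K 𝒜} {p : 𝒜 →ₗ[K] X} {q : 𝒜 →ₗ[K] Y}
    (b : X →ₗ[K] Y →ₗ[K] Z) {S : ℤ → Submodule K 𝒜} {a c d e : ℤ}
    (hp : ∀ t ≠ a, ∀ x ∈ S t, p x = 0) (hq : ∀ t ≠ c, ∀ x ∈ S t, q x = 0) (hZ : Z ≤ S e)
    (hd : a + c + d = e) : liftBilin p q b ∈ weightSubmodule S d := by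
  refine ofBilin_mem_weightSubmodule fun s t x y hx hy => ?_
  change (b (p x) (q y) : 𝒜) ∈ _
  by_cases hs : s = a
  · by_cases ht : t = c
    · rw [hs, ht, hd]
      exact hZ (Subtype.property _)
    · rw [hq t ht y hy, map_zero, Submodule.coe_zero]
      exact zero_mem _
  · rw [hp s hs x hx, map_zero, LinearMap.zero_apply, Submodule.coe_zero]
    exact zero_mem _

namespace IsQuasiTwilled

variable (h : IsQuasiTwilled A A')

theorem fst_add_snd (x : 𝒜) : (h.fst x : 𝒜) + h.snd x = x := by
  exact Submodule.projection_add_projection_eq_self h.isCompl x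

theorem fst_coe (x : A) : h.fst x = x := Submodule.projectionOnto_apply_left h.isCompl x

theorem snd_coe (x : A') : h.snd x = x := Submodule.projectionOnto_apply_left h.isCompl.symm x

theorem fst_eq_zero {x : 𝒜} (hx : x ∈ A') : h.fst x = 0 :=
  (Submodule.projectionOnto_apply_eq_zero_iff h.isCompl).2 hx

theorem snd_eq_zero_iff {x : 𝒜} : h.snd x = 0 ↔ x ∈ A :=
  Submodule.projectionOnto_apply_eq_zero_iff h.isCompl.symm

theorem fst_eq_zero_of_mem_splitting {t : ℤ} (ht : t ≠ 0) {x : 𝒜} (hx : x ∈ splitting A A' t) :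
    h.fst x = 0 := by
  by_cases h1 : t = 1
  · subst h1
    exact h.fst_eq_zero hx
  · rw [splitting_eq_bot ht h1, Submodule.mem_bot] at hx
    rw [hx, map_zero]

theorem snd_eq_zero_of_mem_splitting {t : ℤ} (ht : t ≠ 1) {x : 𝒜} (hx : x ∈ splitting A A' t) :
    h.snd x = 0 := by
  by_cases h0 : t = 0
  · subst h0
    exact h.snd_eq_zero_iff.2 hx
  · rw [splitting_eq_bot h0 ht, Submodule.mem_bot] at hx
    rw [hx, map_zero]

/-- A cochain is determined by its values on arguments from `A` and `A'`. -/
theorem cochain_ext (h : IsQuasiTwilled A A') {n : ℕ} {f g : Cochain K 𝒜 𝒜 n}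
    (hfg : ∀ x : Fin (n + 1) → 𝒜, (∀ k, x k ∈ A ∨ x k ∈ A') → f x = g x) : f = g := by
  ext x
  have hx : x = (fun k => (h.fst (x k) : 𝒜)) + fun k => (h.snd (x k) : 𝒜) :=
    funext fun k => (h.fst_add_snd (x k)).symm
  rw [hx, MultilinearMap.map_add_univ, MultilinearMap.map_add_univ]
  refine Finset.sum_congr rfl fun s _ => hfg _ fun k => ?_
  by_cases hk : k ∈ s
  · rw [Finset.piecewise_eq_of_mem _ _ _ hk]
    exact Or.inl (h.fst _).2
  · rw [Finset.piecewise_eq_of_notMem _ _ _ hk]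
    exact Or.inr (h.snd _).2

theorem liftHom_apply {n : ℕ} (f : Cochain K A A' n) (x : Fin (n + 1) → 𝒜) :
    h.liftHom n f x = f fun k => h.fst (x k) := rfl

theorem componentHom_apply {n : ℕ} (f : Cochain K 𝒜 𝒜 n) (x : Fin (n + 1) → A) :
    h.componentHom n f x = h.snd (f fun k => (x k : 𝒜)) := rfl

theorem componentHom_liftHom {n : ℕ} (f : Cochain K A A' n) :
    h.componentHom n (h.liftHom n f) = f := by
  ext x
  rw [componentHom_apply, liftHom_apply, snd_coe]
  simp only [fst_coe]

theorem lift_lof {n : ℕ} (f : Cochain K A A' n) :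
    h.lift (DirectSum.lof K ℕ (Cochain K A A') n f) =
      DirectSum.lof K ℕ (Cochain K 𝒜 𝒜) n (h.liftHom n f) :=
  DirectSum.lmap_lof _ _ _

theorem P_lof {n : ℕ} (f : Cochain K 𝒜 𝒜 n) :
    h.P (DirectSum.lof K ℕ (Cochain K 𝒜 𝒜) n f) =
      DirectSum.lof K ℕ (Cochain K 𝒜 𝒜) n (h.liftHom n (h.componentHom n f)) := by
  rw [P, LinearMap.comp_apply, DirectSum.lmap_lof, lift_lof]

theorem component_lift (c : Cochains K A A') : DirectSum.lmap h.componentHom (h.lift c) = c := by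
  induction c using DirectSum.induction_on with
  | zero => simp
  | of n f =>
    change DirectSum.lmap h.componentHom (h.lift (DirectSum.lof K ℕ (Cochain K A A') n f)) = _
    rw [lift_lof, DirectSum.lmap_lof, componentHom_liftHom]
    rfl
  | add x y hx hy => rw [map_add, map_add, hx, hy]

theorem lift_injective : Function.Injective h.lift :=
  Function.LeftInverse.injective h.component_lift

theorem P_comp_P : h.P ∘ₗ h.P = h.P := by
  ext1 n
  ext1 f
  simp only [LinearMap.comp_apply, P, component_lift]

theorem range_P : LinearMap.range h.P = h.F := by
  rw [P, F, LinearMap.range_comp_of_range_eq_top]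
  exact LinearMap.range_eq_top.2 fun c => ⟨_, h.component_lift c⟩

theorem P_mem_cochainGrading (i : ℤ) (x : Cochains K 𝒜 𝒜) (hx : x ∈ cochainGrading K 𝒜 𝒜 i) :
    h.P x ∈ cochainGrading K 𝒜 𝒜 i := by
  rcases exists_lof_of_mem_cochainGrading hx with rfl | ⟨n, f, rfl, rfl⟩
  · simp
  · rw [P_lof]
    exact lof_mem_cochainGrading _

theorem liftHom_apply_eq_zero {n : ℕ} (f : Cochain K A A' n) {x : Fin (n + 1) → 𝒜}
    (k : Fin (n + 1)) (hk : h.fst (x k) = 0) : h.liftHom n f x = 0 := by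
  rw [liftHom_apply, MultilinearMap.map_coord_zero _ k hk, Submodule.coe_zero]

theorem hasWeight_liftHom {n : ℕ} (f : Cochain K A A' n) :
    HasWeight (splitting A A') 1 (h.liftHom n f) := by
  intro t x hx
  by_cases ht : ∀ k ∈ Finset.range (n + 1), t k = 0
  · rw [Finset.sum_eq_zero ht, zero_add]
    exact Subtype.property _
  · push Not at ht
    obtain ⟨k, hk, ht⟩ := ht
    rw [Finset.mem_range] at hk
    rw [evalSeq, h.liftHom_apply_eq_zero f ⟨k, hk⟩
      (h.fst_eq_zero_of_mem_splitting ht (hx k (by omega)))]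
    exact zero_mem _

theorem F_le_weightSubmodule : h.F ≤ weightSubmodule (splitting A A') 1 := by
  rintro _ ⟨c, rfl⟩
  induction c using DirectSum.induction_on with
  | zero => simp
  | of n f =>
    rw [← DirectSum.lof_eq_of K, lift_lof]
    exact lof_mem_weightSubmodule (h.hasWeight_liftHom f)
  | add x y hx hy =>
    rw [map_add]
    exact add_mem hx hy

/-- An argument from `A'` would push the value to weight at least `2`, where the splitting is zero.
On `⊗ⁿ⁺¹ A` the value is in `A'` for `d = 1` and zero for `d ≥ 2`. -/
theorem liftHom_componentHom_of_hasWeight {d : ℤ} (hd : 1 ≤ d) {n : ℕ} {f : Cochain K 𝒜 𝒜 n}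
    (hf : HasWeight (splitting A A') d f) : h.liftHom n (h.componentHom n f) = f := by
  classical
  refine h.cochain_ext fun x hx => ?_
  have hfx := hf.apply_mem (fun k => if x k ∈ A then 0 else 1) x fun k => by
    split_ifs with hk
    · exact hk
    · exact (hx k).resolve_left hk
  by_cases hA : ∀ k, x k ∈ A
  · rw [liftHom_apply, componentHom_apply]
    have hx' : (fun k => (h.fst (x k) : 𝒜)) = x :=
      funext fun k => congrArg Subtype.val (h.fst_coe ⟨x k, hA k⟩)
    rw [hx']
    simp only [hA, if_true, Finset.sum_const_zero, zero_add] at hfx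
    by_cases h1 : d = 1
    · subst h1
      exact congrArg Subtype.val (h.snd_coe ⟨f x, hfx⟩)
    · rw [splitting_eq_bot (by omega) h1, Submodule.mem_bot] at hfx
      rw [hfx, map_zero, Submodule.coe_zero]
  · push Not at hA
    obtain ⟨k, hk⟩ := hA
    have hsum : (1 : ℤ) ≤ ∑ k, if x k ∈ A then 0 else 1 := by
      refine le_trans (by rw [if_neg hk]) (Finset.single_le_sum
        (f := fun k => if x k ∈ A then (0 : ℤ) else 1) (fun j _ => ?_) (Finset.mem_univ k))
      split_ifs <;> norm_num
    rw [splitting_eq_bot (by omega) (by omega), Submodule.mem_bot] at hfx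
    rw [hfx, h.liftHom_apply_eq_zero _ k (h.fst_eq_zero ((hx k).resolve_left hk))]

theorem P_eq_self {x : Cochains K 𝒜 𝒜} {d : ℤ} (hd : 1 ≤ d)
    (hx : x ∈ weightSubmodule (splitting A A') d) : h.P x = x := by
  have : weightSubmodule (splitting A A') d ≤ LinearMap.eqLocus h.P LinearMap.id := by
    refine Submodule.span_le.2 ?_
    rintro _ ⟨n, f, hf, rfl⟩
    rw [SetLike.mem_coe, LinearMap.mem_eqLocus, P_lof,
      h.liftHom_componentHom_of_hasWeight hd hf, LinearMap.id_apply]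
  exact this hx

theorem P_eq_zero {x : Cochains K 𝒜 𝒜} {d : ℤ} (hd : d ≠ 1)
    (hx : x ∈ weightSubmodule (splitting A A') d) : h.P x = 0 := by
  have : weightSubmodule (splitting A A') d ≤ LinearMap.ker h.P := by
    refine Submodule.span_le.2 ?_
    rintro _ ⟨n, f, hf, rfl⟩
    have : h.componentHom n f = 0 := by
      ext1 a
      rw [componentHom_apply]
      have := hf.apply_mem (fun _ => 0) (fun k => (a k : 𝒜)) fun k => (a k).2
      rw [Finset.sum_const_zero, zero_add] at this
      exact h.snd_eq_zero_of_mem_splitting hd this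
    rw [SetLike.mem_coe, LinearMap.mem_ker, P_lof, this, map_zero, map_zero]
  exact this hx

/-- In weight `≥ 2`, `P` both fixes and kills the cochain. -/
theorem eq_zero_of_mem_weightSubmodule (h : IsQuasiTwilled A A') {x : Cochains K 𝒜 𝒜} {d : ℤ}
    (hd : 2 ≤ d) (hx : x ∈ weightSubmodule (splitting A A') d) : x = 0 := by
  rw [← h.P_eq_self (by omega) hx, h.P_eq_zero (by omega) hx]

theorem gerstenhaber_F {x y : Cochains K 𝒜 𝒜} (hx : x ∈ h.F) (hy : y ∈ h.F) :
    gerstenhaber K 𝒜 x y = 0 :=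
  h.eq_zero_of_mem_weightSubmodule (d := 1 + 1) (by norm_num) (gerstenhaber_mem_weightSubmodule
    (h.F_le_weightSubmodule hx) (h.F_le_weightSubmodule hy))

theorem F_isGradedLieSubalgebra :
    IsGradedLieSubalgebra (cochainGrading K 𝒜 𝒜) (gerstenhaber K 𝒜) h.F where
  graded := by
    refine le_antisymm ?_ (iSup_le fun i => inf_le_left)
    rintro _ ⟨c, rfl⟩
    induction c using DirectSum.induction_on with
    | zero => simp
    | of n f =>
      refine Submodule.mem_iSup_of_mem (n : ℤ) ⟨⟨_, rfl⟩, ?_⟩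
      rw [← DirectSum.lof_eq_of K, lift_lof]
      exact lof_mem_cochainGrading _
    | add x y hx hy =>
      rw [map_add]
      exact add_mem hx hy
  closed x hx y hy := by
    rw [h.gerstenhaber_F hx hy]
    exact zero_mem _

/-- The kernel of `P` consists of the cochains that preserve `A`. -/
theorem ker_P : LinearMap.ker h.P = weightSubmodule (fun _ => A) 0 := by
  classical
  refine le_antisymm (fun c hc => ?_) (Submodule.span_le.2 ?_)
  · have hc' : DirectSum.lmap h.componentHom c = 0 :=
      h.lift_injective (by rw [map_zero]; exact hc)
    rw [← DirectSum.sum_support_of c]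
    refine sum_mem fun n _ => lof_mem_weightSubmodule fun t x hx => ?_
    have hn : h.componentHom n (c n) = 0 := by
      have := congrArg (fun c => c n) hc'
      simpa [DirectSum.lmap_apply] using this
    rw [← h.snd_eq_zero_iff]
    exact congrArg (fun f : Cochain K A A' n => f fun k => ⟨x k, hx k (by omega)⟩) hn
  · rintro _ ⟨n, f, hf, rfl⟩
    have : h.componentHom n f = 0 := by
      ext1 a
      rw [componentHom_apply]
      exact h.snd_eq_zero_iff.2
        (hf.apply_mem (fun _ => 0) (fun k => (a k : 𝒜)) fun k => (a k).2)
    rw [SetLike.mem_coe, LinearMap.mem_ker, P_lof, this, map_zero, map_zero]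

/-- For the constant family `A`, weight `0` means preserving `A`, so closure is additivity of
weights, `0 + 0 = 0`. -/
theorem ker_P_isGradedLieSubalgebra :
    IsGradedLieSubalgebra (cochainGrading K 𝒜 𝒜) (gerstenhaber K 𝒜) (LinearMap.ker h.P) where
  graded := by
    rw [ker_P]
    exact weightSubmodule_eq_iSup _ _
  closed x hx y hy := by
    rw [ker_P] at hx hy ⊢
    have := gerstenhaber_mem_weightSubmodule hx hy
    rwa [add_zero] at this

theorem gerstenhaber_mem {d e : ℤ} {x f : Cochains K 𝒜 𝒜}
    (hx : x ∈ weightSubmodule (splitting A A') d) (hf : f ∈ h.F) (hd : d + 1 = e) :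
    gerstenhaber K 𝒜 x f ∈ weightSubmodule (splitting A A') e := by
  rw [← hd]
  exact gerstenhaber_mem_weightSubmodule hx (h.F_le_weightSubmodule hf)

theorem coe_toF (D : A →ₗ[K] A') :
    (h.toF D : Cochains K 𝒜 𝒜) = ofLin (A'.subtype ∘ₗ D ∘ₗ h.fst) :=
  (h.lift_lof _).trans (lof_eq_lof rfl fun _ => rfl)

variable [IsScalarTower K 𝒜 𝒜] [SMulCommClass K 𝒜 𝒜]

theorem isCurvedVData :
    IsCurvedVData (cochainGrading K 𝒜 𝒜) (gerstenhaber K 𝒜) h.F h.P (mulCochain K 𝒜) where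
  gradedLie := gerstenhaber_isGradedLieAlgebra K 𝒜
  subalgebra := h.F_isGradedLieSubalgebra
  abelian _ hx _ hy := h.gerstenhaber_F hx hy
  proj := h.P_comp_P
  range_proj := h.range_P
  ker_proj := h.ker_P_isGradedLieSubalgebra
  degree_one := lof_mem_cochainGrading (bilinCochain (LinearMap.mul K 𝒜))
  square_zero := gerstenhaber_ofBilin_self mul_assoc

end IsQuasiTwilled

end QuasiTwilled

/-! ### The brackets `lₖ` and the Maurer–Cartan equation. -/

section QuasiTwilled

variable {K : Type*} [Field K] {𝒜 : Type*} [NonUnitalRing 𝒜] [Module K 𝒜]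
  [IsScalarTower K 𝒜 𝒜] [SMulCommClass K 𝒜 𝒜] {A A' : Submodule K 𝒜}

namespace IsQuasiTwilled

variable (h : IsQuasiTwilled A A')

theorem mulCochain_eq_sum : mulCochain K 𝒜 =
    h.hatπ + h.hatξ + h.hatη + h.hatβ + h.hatρ + h.hatμ + h.hatθ := by
  simp only [hatπ, hatξ, hatη, hatβ, hatρ, hatμ, hatθ, liftBilin, mulCochain, ← ofBilin_add]
  congr 1
  ext x y
  change x * y = (h.fst (h.fst x * h.fst y) : 𝒜) + h.fst (h.fst x * h.snd y) +
    h.fst (h.snd x * h.fst y) + h.snd (h.snd x * h.snd y) + h.snd (h.fst x * h.snd y) +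
    h.snd (h.snd x * h.fst y) + h.snd (h.fst x * h.fst y)
  -- The eighth component `A' ⊗ A' → A` is absent: this is where closure of `A'` under
  -- multiplication enters.
  have hβ : (h.fst (h.snd x * h.snd y) : 𝒜) = 0 := by
    rw [h.fst_eq_zero (h.mul_mem _ (h.snd x).2 _ (h.snd y).2), Submodule.coe_zero]
  conv_lhs => rw [← h.fst_add_snd x, ← h.fst_add_snd y, add_mul, mul_add, mul_add,
    ← h.fst_add_snd (h.fst x * h.fst y), ← h.fst_add_snd (h.fst x * h.snd y),
    ← h.fst_add_snd (h.snd x * h.fst y), ← h.fst_add_snd (h.snd x * h.snd y), hβ]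
  abel

/-- The part `π + ρ + μ` of the multiplication. -/
def weightZeroPart : Cochains K 𝒜 𝒜 := h.hatπ + h.hatρ + h.hatμ

/-- The part `ξ + η + β` of the multiplication. -/
def weightNegOnePart : Cochains K 𝒜 𝒜 := h.hatξ + h.hatη + h.hatβ

theorem mulCochain_eq : mulCochain K 𝒜 = h.hatθ + h.weightZeroPart + h.weightNegOnePart := by
  rw [h.mulCochain_eq_sum, weightZeroPart, weightNegOnePart]
  abel

theorem hatθ_mem : h.hatθ ∈ weightSubmodule (splitting A A') 1 :=
  liftBilin_mem_weightSubmodule _ (fun _ ht _ hx => h.fst_eq_zero_of_mem_splitting ht hx)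
    (fun _ ht _ hx => h.fst_eq_zero_of_mem_splitting ht hx) splitting_one.ge (by norm_num)

theorem weightZeroPart_mem : h.weightZeroPart ∈ weightSubmodule (splitting A A') 0 := by
  refine add_mem (add_mem ?_ ?_) ?_
  · exact liftBilin_mem_weightSubmodule _ (fun _ ht _ hx => h.fst_eq_zero_of_mem_splitting ht hx)
      (fun _ ht _ hx => h.fst_eq_zero_of_mem_splitting ht hx) splitting_zero.ge (by norm_num)
  · exact liftBilin_mem_weightSubmodule _ (fun _ ht _ hx => h.fst_eq_zero_of_mem_splitting ht hx)
      (fun _ ht _ hx => h.snd_eq_zero_of_mem_splitting ht hx) splitting_one.ge (by norm_num)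
  · exact liftBilin_mem_weightSubmodule _ (fun _ ht _ hx => h.snd_eq_zero_of_mem_splitting ht hx)
      (fun _ ht _ hx => h.fst_eq_zero_of_mem_splitting ht hx) splitting_one.ge (by norm_num)

theorem weightNegOnePart_mem : h.weightNegOnePart ∈ weightSubmodule (splitting A A') (-1) := by
  refine add_mem (add_mem ?_ ?_) ?_
  · exact liftBilin_mem_weightSubmodule _ (fun _ ht _ hx => h.fst_eq_zero_of_mem_splitting ht hx)
      (fun _ ht _ hx => h.snd_eq_zero_of_mem_splitting ht hx) splitting_zero.ge (by norm_num)
  · exact liftBilin_mem_weightSubmodule _ (fun _ ht _ hx => h.snd_eq_zero_of_mem_splitting ht hx)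
      (fun _ ht _ hx => h.fst_eq_zero_of_mem_splitting ht hx) splitting_zero.ge (by norm_num)
  · exact liftBilin_mem_weightSubmodule _ (fun _ ht _ hx => h.snd_eq_zero_of_mem_splitting ht hx)
      (fun _ ht _ hx => h.snd_eq_zero_of_mem_splitting ht hx) splitting_one.ge (by norm_num)

theorem P_mulCochain : h.P (mulCochain K 𝒜) = h.hatθ := by
  rw [h.mulCochain_eq, map_add, map_add, h.P_eq_self le_rfl h.hatθ_mem,
    h.P_eq_zero (by norm_num) h.weightZeroPart_mem,
    h.P_eq_zero (by norm_num) h.weightNegOnePart_mem, add_zero, add_zero]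

theorem gerstenhaber_mulCochain {f : Cochains K 𝒜 𝒜} (hf : f ∈ h.F) :
    gerstenhaber K 𝒜 (mulCochain K 𝒜) f =
      gerstenhaber K 𝒜 h.weightZeroPart f + gerstenhaber K 𝒜 h.weightNegOnePart f := by
  rw [h.mulCochain_eq, map_add, map_add, LinearMap.add_apply, LinearMap.add_apply,
    h.eq_zero_of_mem_weightSubmodule le_rfl (h.gerstenhaber_mem h.hatθ_mem hf rfl), zero_add]

theorem P_gerstenhaber_mulCochain {f : Cochains K 𝒜 𝒜} (hf : f ∈ h.F) :
    h.P (gerstenhaber K 𝒜 (mulCochain K 𝒜) f) = gerstenhaber K 𝒜 h.weightZeroPart f := by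
  rw [h.gerstenhaber_mulCochain hf, map_add,
    h.P_eq_self le_rfl (h.gerstenhaber_mem h.weightZeroPart_mem hf (by norm_num)),
    h.P_eq_zero (d := 0) (by norm_num)
      (h.gerstenhaber_mem h.weightNegOnePart_mem hf (by norm_num)), add_zero]

/-- The contributions of `θ` and `π + ρ + μ` reach weight `≥ 2`; that of `ξ + η + β` ends in weight
`1`, so `P` will fix it. -/
theorem gerstenhaber_gerstenhaber_mulCochain {f g : Cochains K 𝒜 𝒜} (hf : f ∈ h.F)
    (hg : g ∈ h.F) :
    gerstenhaber K 𝒜 (gerstenhaber K 𝒜 (mulCochain K 𝒜) f) g =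
      gerstenhaber K 𝒜 (gerstenhaber K 𝒜 h.weightNegOnePart f) g := by
  rw [h.gerstenhaber_mulCochain hf, map_add, LinearMap.add_apply,
    h.eq_zero_of_mem_weightSubmodule le_rfl
      (h.gerstenhaber_mem (h.gerstenhaber_mem h.weightZeroPart_mem hf rfl) hg (by norm_num)),
    zero_add]

theorem gerstenhaber_gerstenhaber_weightNegOnePart_mem {f g : Cochains K 𝒜 𝒜} (hf : f ∈ h.F)
    (hg : g ∈ h.F) :
    gerstenhaber K 𝒜 (gerstenhaber K 𝒜 h.weightNegOnePart f) g ∈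
      weightSubmodule (splitting A A') 1 :=
  h.gerstenhaber_mem (h.gerstenhaber_mem h.weightNegOnePart_mem hf rfl) hg (by norm_num)

theorem iterated_gerstenhaber_mulCochain_eq_zero {f g k : Cochains K 𝒜 𝒜} (hf : f ∈ h.F)
    (hg : g ∈ h.F) (hk : k ∈ h.F) :
    gerstenhaber K 𝒜 (gerstenhaber K 𝒜 (gerstenhaber K 𝒜 (mulCochain K 𝒜) f) g) k = 0 := by
  rw [h.gerstenhaber_gerstenhaber_mulCochain hf hg]
  exact h.eq_zero_of_mem_weightSubmodule le_rfl
    (h.gerstenhaber_mem (h.gerstenhaber_gerstenhaber_weightNegOnePart_mem hf hg) hk (by norm_num))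

theorem coe_l_zero (v : Fin 0 → h.F) : (h.l 0 v : Cochains K 𝒜 𝒜) = h.hatθ := h.P_mulCochain

theorem coe_l_one (v : Fin 1 → h.F) :
    (h.l 1 v : Cochains K 𝒜 𝒜) = gerstenhaber K 𝒜 h.weightZeroPart (v 0) :=
  h.P_gerstenhaber_mulCochain (v 0).2

theorem coe_l_two (v : Fin 2 → h.F) :
    (h.l 2 v : Cochains K 𝒜 𝒜) =
      gerstenhaber K 𝒜 (gerstenhaber K 𝒜 h.weightNegOnePart (v 0)) (v 1) := by
  refine (congrArg h.P (h.gerstenhaber_gerstenhaber_mulCochain (v 0).2 (v 1).2)).trans ?_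
  exact h.P_eq_self le_rfl
    (h.gerstenhaber_gerstenhaber_weightNegOnePart_mem (v 0).2 (v 1).2)

theorem l_eq_zero (k : ℕ) (hk : 3 ≤ k) : h.l k = 0 :=
  derivedBracket_eq_zero _ (fun _ hx _ hy _ hz =>
    h.iterated_gerstenhaber_mulCochain_eq_zero hx hy hz) k hk

theorem isCurvedLInfinity (hK : (2 : K) ≠ 0) : IsCurvedLInfinity (L := h.F) h.gradingF h.l :=
  h.isCurvedVData.isCurvedLInfinity hK h.P_mem_cochainGrading _ fun _ hx _ hy _ hz =>
    h.iterated_gerstenhaber_mulCochain_eq_zero hx hy hz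

/-- The Maurer–Cartan series of a linear map measures its failure to be a right deformation
map. -/
theorem maurerCartan_series (hK : (2 : K) ≠ 0) (D : A →ₗ[K] A') :
    ∃ b : 𝒜 →ₗ[K] 𝒜 →ₗ[K] 𝒜,
      h.hatθ + gerstenhaber K 𝒜 h.weightZeroPart (h.toF D) +
        (2 : K)⁻¹ • gerstenhaber K 𝒜 (gerstenhaber K 𝒜 h.weightNegOnePart (h.toF D)) (h.toF D) =
          ofBilin b ∧
      ∀ x y, b x y =
        ((h.mapρ (h.fst x) (D (h.fst y)) + h.mapμ (D (h.fst x)) (h.fst y) +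
          h.mapβ (D (h.fst x)) (D (h.fst y)) + h.mapθ (h.fst x) (h.fst y) -
        D (h.mapπ (h.fst x) (h.fst y) + h.mapξ (h.fst x) (D (h.fst y)) +
          h.mapη (D (h.fst x)) (h.fst y)) : A') : 𝒜) := by
  rw [coe_toF]
  simp only [weightZeroPart, weightNegOnePart, hatπ, hatξ, hatη, hatβ, hatρ, hatμ, hatθ, liftBilin,
    ← ofBilin_add, gerstenhaber_ofBilin_ofLin, ← ofBilin_smul]
  refine ⟨_, rfl, fun x y => ?_⟩
  -- The lift of `D` takes values in `A'` and kills `A'`, so it squares to zero.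
  have h1 : ∀ u : A', h.fst u = 0 := fun u => h.fst_eq_zero u.2
  simp only [LinearMap.add_apply, LinearMap.sub_apply, LinearMap.smul_apply, LinearMap.comp_apply,
    LinearMap.compl₂_apply, LinearMap.compr₂_apply, LinearMap.compl₁₂_apply,
    Submodule.subtype_apply, map_add, map_sub, h1, h.fst_coe, h.snd_coe, map_zero,
    LinearMap.zero_apply, Submodule.coe_add, Submodule.coe_sub]
  -- In the double bracket `β(Dx, Dy)`, `-Dξ(x, Dy)` and `-Dη(Dx, y)` each occur twice, which
  -- cancels the factor `1/2`.
  match_scalars <;> field_simp <;> norm_num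

theorem isRightDeformationMap_iff (hK : (2 : K) ≠ 0) (D : A →ₗ[K] A') :
    h.IsRightDeformationMap D ↔ IsMaurerCartan (L := h.F) h.gradingF h.l (h.toF D) := by
  have hsupp : ∀ k, 3 ≤ k → h.l k (fun _ => h.toF D) = 0 := fun k hk => by
    rw [h.l_eq_zero k hk]
    rfl
  have hsum : ∑ᶠ k : ℕ, ((k.factorial : K)⁻¹ • h.l k (fun _ => h.toF D)) =
      h.l 0 (fun _ => h.toF D) + h.l 1 (fun _ => h.toF D) +
        (2 : K)⁻¹ • h.l 2 (fun _ => h.toF D) := by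
    rw [finsum_eq_sum_of_support_subset (s := Finset.range 3)]
    · simp [Finset.sum_range_succ]
    · intro k hk
      by_contra hk'
      refine hk ?_
      dsimp only
      rw [hsupp k (by simpa using hk'), smul_zero]
  obtain ⟨b, hb, hbxy⟩ := h.maurerCartan_series hK D
  have hiff : h.IsRightDeformationMap D ↔
      ∑ᶠ k : ℕ, ((k.factorial : K)⁻¹ • h.l k (fun _ => h.toF D)) = 0 := by
    rw [hsum, ← Submodule.coe_eq_zero, Submodule.coe_add, Submodule.coe_add, Submodule.coe_smul,
      coe_l_zero, coe_l_one, coe_l_two, hb, ofBilin_eq_zero_iff]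
    simp only [hbxy, Submodule.coe_eq_zero, sub_eq_zero]
    constructor
    · exact fun H x y => (H _ _).symm
    · intro H x y
      have := H x y
      rw [h.fst_coe, h.fst_coe] at this
      exact this.symm
  rw [hiff]
  constructor
  · refine fun H => ⟨?_, (Set.finite_lt_nat 3).subset fun k hk => ?_, H⟩
    · change (h.toF D : Cochains K 𝒜 𝒜) ∈ cochainGrading K 𝒜 𝒜 0
      rw [coe_toF]
      exact lof_mem_cochainGrading _
    · by_contra hk'
      exact hk (hsupp k (by simpa using hk'))
  · exact fun H => H.sum_eq_zero

end IsQuasiTwilled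

end QuasiTwilled

end QuasiTwilled

end

open QuasiTwilled in
theorem theorem3 {K : Type*} [Field K] (hK : (2 : K) ≠ 0)
    {𝒜 : Type*} [NonUnitalRing 𝒜] [Module K 𝒜] [IsScalarTower K 𝒜 𝒜] [SMulCommClass K 𝒜 𝒜]
    {A A' : Submodule K 𝒜} (h : IsQuasiTwilled A A') :
    -- the multiplication is the sum of its seven components
    mulCochain K 𝒜 = h.hatπ + h.hatξ + h.hatη + h.hatβ + h.hatρ + h.hatμ + h.hatθ ∧
    -- `⨁ Hom(⊗ⁿ⁺¹ A, A')` is embedded by the lift, with image `F`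
    Function.Injective h.lift ∧
    -- the curved V-data
    IsCurvedVData (cochainGrading K 𝒜 𝒜) (gerstenhaber K 𝒜) h.F h.P (mulCochain K 𝒜) ∧
    -- the curved `L∞`-algebra
    IsCurvedLInfinity (L := h.F) h.gradingF h.l ∧
    (h.l 0 ![] : Cochains K 𝒜 𝒜) = h.hatθ ∧
    (∀ f : h.F, (h.l 1 ![f] : Cochains K 𝒜 𝒜) =
      gerstenhaber K 𝒜 (h.hatπ + h.hatρ + h.hatμ) f) ∧
    (∀ f g : h.F, (h.l 2 ![f, g] : Cochains K 𝒜 𝒜) =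
      gerstenhaber K 𝒜 (gerstenhaber K 𝒜 (h.hatξ + h.hatη + h.hatβ) f) g) ∧
    (∀ k : ℕ, 3 ≤ k → h.l k = 0) ∧
    -- right deformation maps are the Maurer–Cartan elements
    (∀ D : A →ₗ[K] A', h.IsRightDeformationMap D ↔ IsMaurerCartan (L := h.F) h.gradingF h.l (h.toF D)) :=
  ⟨h.mulCochain_eq_sum, h.lift_injective, h.isCurvedVData, h.isCurvedLInfinity hK,
    h.coe_l_zero _, fun f => h.coe_l_one ![f], fun f g => h.coe_l_two ![f, g], h.l_eq_zero,
    h.isRightDeformationMap_iff hK⟩
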